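/- All graphs are finite and simple. A star is a tree obtained from a single vertex $v$ by adding a (possibly empty) set of new vertices, each made adjacent exactly to $v$; a forest of stars is a graph each of whose connected components is a star. For a graph $G$, let $\alpha_{\mathcal S}(G)$ denote the maximum order of an induced subgraph of $G$ that is a forest of stars. A function $f:\mathbb N\to[0,1]$ (with $0\in\mathbb N$) is called a lower bound for $\alpha_{\mathcal S}$ if $\alpha_{\mathcal S}(G)\ge \sum_{v\in V(G)} f(d_G(v))$ for every graph $G$, where $d_G(v)$ is the degree of $v$ in $G$. A lower bound $f$ is extremal if there is no $g:\mathbb N\to[0,1]$ with $g\not\equiv 0$ such that $f+g$ is also a lower bound for $\alpha_{\mathcal S}$. A lower bound $f$ is dominated by a lower bound $f'$ if $f(d)\le f'(d)$ for every $d\in\mathbb N$. For $\varepsilon\in\mathbb R$ with $0\le\varepsilon\le\frac16$, define $f_\varepsilon:\mathbb N\to[0,1]$ by \[ f_\varepsilon(d)=\begin{cases}1 & \text{if } d=0,\\ 1-\varepsilon & \text{if } d=1,\\ \min\left\{\frac35,\frac12+\varepsilon\right\} & \text{if } d=2,\\ \min\left\{\frac2{d+1},\frac1d+\varepsilon\right\}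 & \text{if } d\ge 3.\end{cases} \] Then for every $\varepsilon\in[0,\frac16]$ the function $f_\varepsilon$ is a lower bound for $\alpha_{\mathcal S}$, that is, $\alpha_{\mathcal S}(G)\ge\sum_{v\in V(G)}f_\varepsilon(d_G(v))$ for every graph $G$. Moreover, this lower bound $f_\varepsilon$ is extremal, and every lower bound for $\alpha_{\mathcal S}$ is dominated by $f_\varepsilon$ for some $\varepsilon\in[0,\frac16]$. -/

import Mathlib

universe u

/-- A class of graphs. -/
def GraphClass : Type (u + 1) := ∀ V : Type u, SimpleGraph V → Prop

/-- `inducedOrder C G` is the maximum order of an induced subgraph of the finite graph `G` that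
belongs to the class `C`. -/
noncomputable def inducedOrder (C : GraphClass.{u}) {V : Type u} [Fintype V]
    (G : SimpleGraph V) : ℕ :=
  sSup {n : ℕ | ∃ s : Finset V, C _ (G.induce (s : Set V)) ∧ s.card = n}

/-- `degreeSum f G` is the sum of `f (deg v)` over all vertices `v` of `G`. -/
def degreeSum (f : ℕ → ℝ) {V : Type u} [Fintype V] (G : SimpleGraph V)
    [DecidableRel G.Adj] : ℝ :=
  ∑ v : V, f (G.degree v)

/-- `f : ℕ → [0, 1]` is a lower bound for the maximum order of an induced subgraph in `C`,
over all finite simple graphs. -/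
def IsLowerBound (C : GraphClass.{u}) (f : ℕ → ℝ) : Prop :=
  (∀ d, f d ∈ Set.Icc (0 : ℝ) 1) ∧
    ∀ (V : Type u) [Fintype V] (G : SimpleGraph V) [DecidableRel G.Adj],
      degreeSum f G ≤ (inducedOrder C G : ℝ)

/-- A lower bound is extremal if no nonzero `g : ℕ → [0, 1]` can be added to it. -/
def IsExtremalLowerBound (C : GraphClass.{u}) (f : ℕ → ℝ) : Prop :=
  IsLowerBound C f ∧
    ¬ ∃ g : ℕ → ℝ, (∀ d, g d ∈ Set.Icc (0 : ℝ) 1) ∧ g ≠ 0 ∧ IsLowerBound C (f + g)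

/-- `f` is dominated by `f'`. -/
def IsDominatedBy (f f' : ℕ → ℝ) : Prop := ∀ d, f d ≤ f' d

/-- A star: some vertex `r` is adjacent to all the other vertices, and there are no other edges.
A single vertex is a star. -/
def IsStar {V : Type u} (G : SimpleGraph V) : Prop :=
  ∃ r : V, G = SimpleGraph.starGraph r

/-- Forests of stars: the graphs in which every connected component is a star. -/
def forestsOfStars : GraphClass.{u} := fun _ G =>
  ∀ c : G.ConnectedComponent, IsStar c.toSimpleGraph

/-- The function `f_ε`. -/
noncomputable def starBound (ε : ℝ) : ℕ → ℝ
  | 0 => 1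
  | 1 => 1 - ε
  | 2 => min (3 / 5) (1 / 2 + ε)
  | d => min (2 / ((d : ℝ) + 1)) (1 / (d : ℝ) + ε)

/-! Lower bound. A stronger statement, `HasPacking`, is proved by strong induction on a vertex set
`A`. It allows a set `X` of marked vertices, which may not serve as leaves and weigh only 1/(d+1).
Marks arise from unmarked vertices y of degree one: delete y and mark its neighbour z. Afterwards y
can always be put back, as a leaf at z if z is a centre and as an isolated vertex otherwise. The
weights 1-ε of y and at most 1/d+ε of z add up to at most 1+1/d, and 1/d is the marked weight of z
after the deletion (`HasPacking.of_leaf`).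

When every unmarked vertex has degree at least two, the weights are monotone in ε, so ε = 1/6 may be
assumed. If some degree is large, a vertex minimizing weight/degree can be deleted: its neighbours
gain at least what is lost (`HasPacking.of_large`). Otherwise marked degrees are at most two and
unmarked degrees are two or three, and every edge lost by a surviving vertex is worth at least 1/10.
This permits local reductions: choose an induced star forest, delete it with all its neighbours, and
compare its order with the weight lost (`HasPacking.reduce_list`). Such reductions eliminate the
marked vertices and then all vertices of degree two (`Irreducible.card_ne_two`). In the remaining
cubic graph the larger side of a maximum cut has at least half of the vertices and maximum degree at
most one (`hasPacking_of_cubic`).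

Domination and extremality. Complete graphs, the 5-cycle and complete graphs with pendant vertices
bound any lower bound φ by 2/(d+1), by 3/5 at d = 2, and by 1/d+(1-φ(1)). Hence φ is dominated with
ε = min(1/6, 1-φ(1)). Extremality follows because the values at 1 and 3 make distinct functions
`starBound ε` incomparable. -/

namespace StarForest

/-! ### The strengthened statement with marked vertices. -/

/-- The neighbours of `v` inside `A`. -/
def nbrs {V : Type u} (G : SimpleGraph V) [DecidableRel G.Adj] (A : Finset V) (v : V) :
    Finset V := A.filter (G.Adj v)

/-- `C` and `L` are the centres and the leaves of an induced forest of stars. -/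
structure IsStarPair {V : Type u} (G : SimpleGraph V) (C L : Finset V) : Prop where
  disj : Disjoint C L
  indepC : ∀ u ∈ C, ∀ v ∈ C, ¬ G.Adj u v
  indepL : ∀ u ∈ L, ∀ v ∈ L, ¬ G.Adj u v
  uniq : ∀ l ∈ L, ∀ c ∈ C, ∀ c' ∈ C, G.Adj l c → G.Adj l c' → c = c'

/-- The weight of a vertex of degree `d`; marked vertices are only allowed as centres. -/
noncomputable def weight (ε : ℝ) (marked : Prop) [Decidable marked] (d : ℕ) : ℝ :=
  if marked then 1 / ((d : ℝ) + 1) else starBound ε d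

/-- `A` contains an induced forest of stars of order at least the total weight of `A`, in which
the marked vertices `X` are not used as leaves. -/
def HasPacking {V : Type u} [DecidableEq V] (G : SimpleGraph V) [DecidableRel G.Adj]
    (ε : ℝ) (A X : Finset V) : Prop :=
  ∃ C L : Finset V, C ⊆ A ∧ L ⊆ A ∧ IsStarPair G C L ∧ Disjoint L X ∧
    ∑ v ∈ A, weight ε (v ∈ X) (nbrs G A v).card ≤ (C.card : ℝ) + L.card

/-! ### Numerical properties of the weights. -/

section weights

lemma starBound_zero (ε : ℝ) : starBound ε 0 = 1 := rfl
lemma starBound_one (ε : ℝ) : starBound ε 1 = 1 - ε := rfl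
lemma starBound_two (ε : ℝ) : starBound ε 2 = min (3 / 5) (1 / 2 + ε) := rfl
lemma starBound_of_three_le (ε : ℝ) {d : ℕ} (hd : 3 ≤ d) :
    starBound ε d = min (2 / ((d : ℝ) + 1)) (1 / (d : ℝ) + ε) := by
  obtain ⟨n, rfl⟩ := Nat.exists_eq_add_of_le' hd
  rfl

lemma starBound_le_add {ε : ℝ} (h0 : 0 ≤ ε) {d : ℕ} (hd : 1 ≤ d) :
    starBound ε d ≤ 1 / (d : ℝ) + ε := by
  rcases (by omega : d = 1 ∨ d = 2 ∨ 3 ≤ d) with rfl | rfl | h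
  · rw [starBound_one]; norm_num; linarith
  · rw [starBound_two]; exact (min_le_right _ _).trans (by norm_num)
  · rw [starBound_of_three_le _ h]; exact min_le_right _ _

/-- Only degree one, where the value is 1-ε, goes the other way; this permits passing to ε = 1/6
once unmarked leaves are gone. -/
lemma starBound_mono {ε δ : ℝ} (h : ε ≤ δ) {d : ℕ} (hd : 2 ≤ d) :
    starBound ε d ≤ starBound δ d := by
  rcases (by omega : d = 2 ∨ 3 ≤ d) with rfl | h'
  · rw [starBound_two, starBound_two]; exact min_le_min le_rfl (by linarith)
  · rw [starBound_of_three_le _ h', starBound_of_three_le _ h']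
    exact min_le_min le_rfl (by linarith)

lemma starBound_sixth_one : starBound (1 / 6) 1 = 5 / 6 := by rw [starBound_one]; norm_num
lemma starBound_sixth_two : starBound (1 / 6) 2 = 3 / 5 := by rw [starBound_two]; norm_num
lemma starBound_sixth {d : ℕ} (hd : 3 ≤ d) : starBound (1 / 6) d = 2 / ((d : ℝ) + 1) := by
  rw [starBound_of_three_le _ hd, min_eq_left]
  have : (3 : ℝ) ≤ d := by exact_mod_cast hd
  rw [div_add' _ _ _ (by positivity), div_le_div_iff₀ (by positivity) (by positivity)]
  nlinarith [mul_nonneg (by linarith : (0 : ℝ) ≤ d - 2) (by linarith : (0 : ℝ) ≤ d - 3)]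
lemma starBound_sixth_three : starBound (1 / 6) 3 = 1 / 2 := by
  rw [starBound_sixth le_rfl]; norm_num

lemma starBound_mem_Icc {ε : ℝ} (h0 : 0 ≤ ε) (h1 : ε ≤ 1 / 6) (d : ℕ) :
    starBound ε d ∈ Set.Icc (0 : ℝ) 1 := by
  rcases (by omega : d = 0 ∨ d = 1 ∨ d = 2 ∨ 3 ≤ d) with rfl | rfl | rfl | h
  · rw [starBound_zero]; simp
  · rw [starBound_one]; constructor <;> linarith
  · rw [starBound_two]
    exact ⟨le_min (by norm_num) (by linarith), (min_le_left _ _).trans (by norm_num)⟩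
  · rw [starBound_of_three_le _ h]
    have : (3 : ℝ) ≤ d := by exact_mod_cast h
    refine ⟨le_min (by positivity) (by positivity), (min_le_left _ _).trans ?_⟩
    rw [div_le_one (by positivity)]; linarith

lemma weight_marked {ε : ℝ} {p : Prop} [Decidable p] (hp : p) (d : ℕ) :
    weight ε p d = 1 / ((d : ℝ) + 1) := if_pos hp
lemma weight_unmarked {ε : ℝ} {p : Prop} [Decidable p] (hp : ¬ p) (d : ℕ) :
    weight ε p d = starBound ε d := if_neg hp

/-- Marked vertices of degree at least three and unmarked vertices of degree at least four
gain exactly their weight when they lose all their neighbours one after the other. -/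
lemma weight_gain {p : Prop} [Decidable p] {d : ℕ} (hd : 1 ≤ d) (h : ¬ p → 2 ≤ d) :
    min (1 / 10) (weight (1 / 6) p d / d) ≤ weight (1 / 6) p (d - 1) - weight (1 / 6) p d := by
  have h1 : (1 : ℝ) ≤ d := by exact_mod_cast hd
  by_cases hp : p
  · refine (min_le_right _ _).trans ?_
    simp only [weight_marked hp]
    push_cast [Nat.cast_sub hd]
    rw [sub_add_cancel]
    apply le_of_eq
    have : (d : ℝ) ≠ 0 := by positivity
    have : (d : ℝ) + 1 ≠ 0 := by positivity
    field_simp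
    ring
  · simp only [weight_unmarked hp]
    rcases (by have := h hp; omega : d = 2 ∨ d = 3 ∨ 4 ≤ d) with rfl | rfl | h4
    · refine (min_le_left _ _).trans ?_
      rw [starBound_sixth_two, starBound_sixth_one]; norm_num
    · refine (min_le_left _ _).trans ?_
      rw [starBound_sixth_three, starBound_sixth_two]; norm_num
    · refine (min_le_right _ _).trans ?_
      rw [starBound_sixth (by omega), starBound_sixth (by omega)]
      push_cast [Nat.cast_sub hd]
      apply le_of_eq
      have : (d : ℝ) ≠ 0 := by positivity
      have : (d : ℝ) + 1 ≠ 0 := by positivity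
      field_simp
      ring_nf
      field_simp
      norm_num

/-- Every lost edge is worth at least `1 / 10` at small degrees. -/
lemma weight_gain_small {p : Prop} [Decidable p] {d e : ℕ} (hd : 1 ≤ d) (hp : p → d ≤ 2)
    (hp' : ¬ p → 2 ≤ d ∧ d ≤ 3) (he : e ≤ d) :
    weight (1 / 6) p d + (d - e : ℝ) / 10 ≤ weight (1 / 6) p e := by
  by_cases h : p
  · simp only [weight_marked h]
    have := hp h
    interval_cases d <;> interval_cases e <;> norm_num
  · simp only [weight_unmarked h]
    have := hp' h
    rcases (by omega : d = 2 ∨ d = 3) with rfl | rfl <;> interval_cases e <;>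
      norm_num [starBound_sixth_three, starBound_sixth_two, starBound_sixth_one, starBound_zero]

end weights

/-! ### Gluing star pairs and accounting for deleted sets. -/

section basics

variable {V : Type u} {G : SimpleGraph V} {A T X : Finset V}

lemma isStarPair_empty : IsStarPair G ∅ ∅ := by
  constructor <;> simp

lemma IsStarPair.union [DecidableEq V] {C₀ L₀ C₁ L₁ : Finset V} (h₀ : IsStarPair G C₀ L₀)
    (h₁ : IsStarPair G C₁ L₁) (hd : Disjoint (C₀ ∪ L₀) (C₁ ∪ L₁))
    (hn : ∀ u ∈ C₀ ∪ L₀, ∀ v ∈ C₁ ∪ L₁, ¬ G.Adj u v) : IsStarPair G (C₀ ∪ C₁) (L₀ ∪ L₁) := by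
  have hn' : ∀ u ∈ C₀ ∪ L₀, ∀ v ∈ C₁ ∪ L₁, ¬ G.Adj v u := fun u hu v hv h => hn u hu v hv h.symm
  simp only [Finset.disjoint_union_left, Finset.disjoint_union_right, Finset.mem_union] at *
  refine ⟨?_, ?_, ?_, ?_⟩
  · simp only [Finset.disjoint_union_left, Finset.disjoint_union_right]
    exact ⟨⟨h₀.disj, hd.1.2.symm⟩, ⟨hd.2.1, h₁.disj⟩⟩
  · have a := h₀.indepC; have b := h₁.indepC
    intro u hu v hv; grind
  · have a := h₀.indepL; have b := h₁.indepL
    intro u hu v hv; grind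
  · have a := h₀.uniq; have b := h₁.uniq
    intro l hl c hc c' hc'; grind

variable [DecidableRel G.Adj]

lemma mem_nbrs {u v : V} : u ∈ nbrs G A v ↔ u ∈ A ∧ G.Adj v u := by simp [nbrs]

/-- Double counting of the edges between two sets. -/
lemma sum_card_nbrs_comm (A B : Finset V) :
    ∑ v ∈ A, (nbrs G B v).card = ∑ v ∈ B, (nbrs G A v).card := by
  simp only [nbrs, Finset.card_filter]
  rw [Finset.sum_comm]
  simp only [G.adj_comm]

variable [DecidableEq V]

lemma nbrs_sdiff (v : V) : nbrs G (A \ T) v = nbrs G A v \ T := by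
  ext u; simp only [mem_nbrs, Finset.mem_sdiff]; tauto

lemma nbrs_erase_card {u v : V} (hu : u ∈ A) (h : G.Adj v u) :
    (nbrs G (A.erase u) v).card = (nbrs G A v).card - 1 := by
  rw [Finset.erase_eq, nbrs_sdiff, ← Finset.erase_eq, Finset.card_erase_of_mem]
  exact mem_nbrs.2 ⟨hu, h⟩

lemma nbrs_erase_of_not_adj {u v : V} (h : ¬ G.Adj v u) :
    nbrs G (A.erase u) v = nbrs G A v := by
  ext w; simp only [mem_nbrs, Finset.mem_erase]
  refine ⟨fun h => ⟨h.1.2, h.2⟩, fun h' => ⟨⟨?_, h'.1⟩, h'.2⟩⟩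
  rintro rfl; exact h h'.2

lemma card_nbrs_inter (hT : T ⊆ A) (v : V) :
    (nbrs G A v).card = (nbrs G T v).card + (nbrs G (A \ T) v).card := by
  rw [nbrs_sdiff, ← Finset.card_inter_add_card_sdiff (nbrs G A v) T]
  congr 2
  ext u; simp only [mem_nbrs, Finset.mem_inter]
  exact ⟨fun h => ⟨h.2, h.1.2⟩, fun h => ⟨⟨hT h.1, h.2⟩, h.1⟩⟩

/-- The chosen vertices have no neighbour in `A \ T`, so adjoining them to a packing of `A \ T`
creates no edges between the two. -/
lemma HasPacking.extend {ε : ℝ} {C₀ L₀ : Finset V} (hT : T ⊆ A) (hC : C₀ ⊆ T) (hL : L₀ ⊆ T)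
    (hs : IsStarPair G C₀ L₀) (hX : Disjoint L₀ X)
    (hn : ∀ s ∈ C₀ ∪ L₀, nbrs G A s ⊆ T) (ih : HasPacking G ε (A \ T) X)
    (hw : ∑ v ∈ A, weight ε (v ∈ X) (nbrs G A v).card ≤ C₀.card + L₀.card +
      ∑ v ∈ A \ T, weight ε (v ∈ X) (nbrs G (A \ T) v).card) : HasPacking G ε A X := by
  obtain ⟨C, L, hCA, hLA, hst, hLX, hsum⟩ := ih
  have hd : Disjoint (C₀ ∪ L₀) (C ∪ L) := by
    refine Finset.disjoint_of_subset_left (Finset.union_subset hC hL) ?_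
    exact Finset.disjoint_of_subset_right (Finset.union_subset hCA hLA) Finset.disjoint_sdiff
  have hd' := hd
  simp only [Finset.disjoint_union_left, Finset.disjoint_union_right] at hd'
  refine ⟨C₀ ∪ C, L₀ ∪ L, Finset.union_subset (hC.trans hT) (hCA.trans Finset.sdiff_subset),
    Finset.union_subset (hL.trans hT) (hLA.trans Finset.sdiff_subset),
    hs.union hst hd ?_, Finset.disjoint_union_left.2 ⟨hX, hLX⟩, ?_⟩
  · intro u hu v hv huv
    have hv' : v ∈ A \ T := (Finset.union_subset hCA hLA) hv
    rw [Finset.mem_sdiff] at hv'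
    exact hv'.2 (hn u hu (mem_nbrs.2 ⟨hv'.1, huv⟩))
  · rw [Finset.card_union_of_disjoint hd'.1.1, Finset.card_union_of_disjoint hd'.2.2]
    push_cast
    linarith

/-- Deleting a vertex whose weight is at most the gain of its neighbours. -/
lemma HasPacking.of_erase {ε : ℝ} {v : V} (hv : v ∈ A) (ih : HasPacking G ε (A.erase v) X)
    (hw : weight ε (v ∈ X) (nbrs G A v).card ≤ ∑ u ∈ nbrs G A v,
      (weight ε (u ∈ X) ((nbrs G A u).card - 1) - weight ε (u ∈ X) (nbrs G A u).card)) :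
    HasPacking G ε A X := by
  have hw' : ∑ u ∈ A.erase v, (weight ε (u ∈ X) (nbrs G (A.erase v) u).card -
      weight ε (u ∈ X) (nbrs G A u).card) = ∑ u ∈ nbrs G A v,
      (weight ε (u ∈ X) ((nbrs G A u).card - 1) - weight ε (u ∈ X) (nbrs G A u).card) := by
    have hsub : nbrs G A v ⊆ A.erase v := fun u hu => by
      rw [mem_nbrs] at hu
      exact Finset.mem_erase.2 ⟨hu.2.ne', hu.1⟩
    rw [← Finset.sum_subset hsub]
    · refine Finset.sum_congr rfl fun u hu => ?_
      rw [nbrs_erase_card hv (mem_nbrs.1 hu).2.symm]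
    · intro u hu hu'
      rw [nbrs_erase_of_not_adj, sub_self]
      exact fun h => hu' (mem_nbrs.2 ⟨Finset.mem_of_mem_erase hu, h.symm⟩)
  refine HasPacking.extend (T := {v}) (C₀ := ∅) (L₀ := ∅) (by simpa using hv) (by simp) (by simp)
    isStarPair_empty (by simp) (by simp) (by rwa [← Finset.erase_eq]) ?_
  rw [← Finset.erase_eq, ← Finset.add_sum_erase _ _ hv]
  rw [Finset.sum_sub_distrib] at hw'
  simp only [Finset.card_empty, Nat.cast_zero]
  linarith

/-- All degrees inside `A` are small. -/
def SmallDegrees (G : SimpleGraph V) [DecidableRel G.Adj] (A X : Finset V) : Prop :=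
  ∀ v ∈ A, 1 ≤ (nbrs G A v).card ∧ (v ∈ X → (nbrs G A v).card ≤ 2) ∧
    (v ∉ X → 2 ≤ (nbrs G A v).card ∧ (nbrs G A v).card ≤ 3)

/-- Choosing the star pair `(C₀, L₀)` and deleting the rest of `T`. -/
lemma HasPacking.reduce {C₀ L₀ : Finset V} (hA : SmallDegrees G A X) (hT : T ⊆ A)
    (hC : C₀ ⊆ T) (hL : L₀ ⊆ T) (hs : IsStarPair G C₀ L₀) (hX : Disjoint L₀ X)
    (hn : ∀ s ∈ C₀ ∪ L₀, nbrs G A s ⊆ T) (ih : HasPacking G (1 / 6) (A \ T) X)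
    (hw : ∑ t ∈ T, (weight (1 / 6) (t ∈ X) (nbrs G A t).card -
      ((nbrs G A t).card - (nbrs G T t).card : ℝ) / 10) ≤ C₀.card + L₀.card) :
    HasPacking G (1 / 6) A X := by
  refine HasPacking.extend hT hC hL hs hX hn ih ?_
  -- Each edge between `T` and a survivor returns 1/10; by double counting the total equals the edge
  -- term subtracted in `hw`.
  have key : ∑ v ∈ A \ T, (weight (1 / 6) (v ∈ X) (nbrs G A v).card +
      ((nbrs G T v).card : ℝ) / 10) ≤
      ∑ v ∈ A \ T, weight (1 / 6) (v ∈ X) (nbrs G (A \ T) v).card := by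
    refine Finset.sum_le_sum fun v hv => ?_
    obtain ⟨h1, h2, h3⟩ := hA v (Finset.sdiff_subset hv)
    have := card_nbrs_inter (G := G) hT v
    refine le_trans (le_of_eq ?_) (weight_gain_small (d := (nbrs G A v).card) h1 h2 h3
      (by omega))
    rw [this]; push_cast; ring
  have e1 : ∑ t ∈ T, ((nbrs G A t).card - (nbrs G T t).card : ℝ) / 10 =
      ∑ v ∈ A \ T, ((nbrs G T v).card : ℝ) / 10 := by
    rw [← Finset.sum_div, ← Finset.sum_div]
    congr 1
    rw [← Nat.cast_sum, sum_card_nbrs_comm, Nat.cast_sum]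
    refine Finset.sum_congr rfl fun t _ => ?_
    rw [card_nbrs_inter (G := G) hT t]; push_cast; ring
  rw [Finset.sum_sub_distrib, e1] at hw
  rw [Finset.sum_add_distrib] at key
  rw [← Finset.sum_sdiff hT]
  linarith

end basics

/-! ### Reduction rules for isolated vertices, leaves, large degrees and local configurations. -/

section rules

variable {V : Type u} [DecidableEq V] {G : SimpleGraph V} [DecidableRel G.Adj] {A T X : Finset V}

lemma HasPacking.of_isolated {ε : ℝ} (h0 : 0 ≤ ε) (h1 : ε ≤ 1 / 6) {v : V} (hv : v ∈ A)
    (hd : (nbrs G A v).card = 0) (ih : HasPacking G ε (A.erase v) X) : HasPacking G ε A X := by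
  have hd' := Finset.card_eq_zero.1 hd
  refine HasPacking.extend (T := {v}) (C₀ := {v}) (L₀ := ∅) (by simpa using hv) (by simp)
    (by simp) ⟨by simp, by simp, by simp, by simp⟩ (by simp) (by simp [hd'])
    (by rwa [← Finset.erase_eq]) ?_
  rw [← Finset.erase_eq, ← Finset.add_sum_erase _ _ hv]
  refine add_le_add ?_ (Finset.sum_le_sum fun u hu => ?_)
  · rw [hd]
    simp only [weight]
    split_ifs
    · simp
    · simpa using (starBound_mem_Icc h0 h1 0).2
  · rw [nbrs_erase_of_not_adj]
    intro h
    have : u ∈ nbrs G A v := mem_nbrs.2 ⟨Finset.mem_of_mem_erase hu, h.symm⟩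
    simp [hd'] at this

/-- The mark keeps `z` out of the leaves, and `z` is the only neighbour of `y`, so `y` can join the
leaf set of any packing found. The gain of one vertex covers the change of weight at `y` and `z`,
whether or not `z` was marked before. -/
lemma HasPacking.of_leaf {ε : ℝ} (h0 : 0 ≤ ε) {y z : V} (hy : y ∈ A)
    (hyX : y ∉ X) (hd : nbrs G A y = {z}) (ih : HasPacking G ε (A.erase y) (insert z X)) :
    HasPacking G ε A X := by
  have hz : z ∈ A ∧ G.Adj y z := mem_nbrs.1 (hd ▸ Finset.mem_singleton_self z)
  have hyz : ∀ u ∈ A, G.Adj y u → u = z := fun u hu h => by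
    have : u ∈ nbrs G A y := mem_nbrs.2 ⟨hu, h⟩
    simpa [hd] using this
  obtain ⟨C, L, hC, hL, hs, hX, hsum⟩ := ih
  rw [Finset.disjoint_insert_right] at hX
  have hyL : y ∉ L := fun h => by simpa using hL h
  have hyC : y ∉ C := fun h => by simpa using hC h
  have hC' := hC.trans (Finset.erase_subset _ _)
  have hL' := hL.trans (Finset.erase_subset _ _)
  refine ⟨C, insert y L, hC', Finset.insert_subset hy hL', ⟨?_, hs.indepC, ?_, ?_⟩, ?_, ?_⟩
  · exact Finset.disjoint_insert_right.2 ⟨hyC, hs.disj⟩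
  · have hyL' : ∀ u ∈ L, ¬ G.Adj y u := fun u hu h => hX.1 (hyz u (hL' hu) h ▸ hu)
    intro u hu v hv h
    rcases Finset.mem_insert.1 hu with rfl | hu'
    · rcases Finset.mem_insert.1 hv with rfl | hv'
      · exact h.ne rfl
      · exact hyL' v hv' h
    · rcases Finset.mem_insert.1 hv with rfl | hv'
      · exact hyL' u hu' h.symm
      · exact hs.indepL u hu' v hv' h
  · intro l hl c hc c' hc' h h'
    rcases Finset.mem_insert.1 hl with rfl | hl
    · rw [hyz c (hC' hc) h, hyz c' (hC' hc') h']
    · exact hs.uniq l hl c hc c' hc' h h'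
  · exact Finset.disjoint_insert_left.2 ⟨hyX, hX.2⟩
  · rw [Finset.card_insert_of_notMem hyL]
    have hz' : z ∈ A.erase y := Finset.mem_erase.2 ⟨hz.2.ne', hz.1⟩
    rw [← Finset.add_sum_erase _ _ hz'] at hsum
    rw [← Finset.add_sum_erase _ _ hy, ← Finset.add_sum_erase _ _ hz']
    have e : ∑ u ∈ (A.erase y).erase z, weight ε (u ∈ X) (nbrs G A u).card =
        ∑ u ∈ (A.erase y).erase z, weight ε (u ∈ insert z X) (nbrs G (A.erase y) u).card := by
      refine Finset.sum_congr rfl fun u hu => ?_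
      simp only [Finset.mem_erase] at hu
      rw [nbrs_erase_of_not_adj fun h => hu.1 (hyz u hu.2.2 h.symm)]
      simp [weight, hu.1]
    have d1 : 1 ≤ (nbrs G A z).card := Finset.card_pos.2 ⟨y, mem_nbrs.2 ⟨hy, hz.2.symm⟩⟩
    rw [nbrs_erase_card hy hz.2.symm, weight_marked (Finset.mem_insert_self _ _),
      Nat.cast_sub d1] at hsum
    rw [e, weight_unmarked hyX, hd, Finset.card_singleton, starBound_one]
    push_cast at hsum ⊢
    have key : weight ε (z ∈ X) (nbrs G A z).card ≤ 1 / ((nbrs G A z).card : ℝ) + ε := by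
      unfold weight
      split_ifs
      · have : (1 : ℝ) ≤ (nbrs G A z).card := by exact_mod_cast d1
        have : 1 / (((nbrs G A z).card : ℝ) + 1) ≤ 1 / ((nbrs G A z).card : ℝ) :=
          one_div_le_one_div_of_le (by linarith) (by linarith)
        linarith
      · exact starBound_le_add h0 d1
    rw [sub_add_cancel] at hsum
    linarith

/-- If some vertex has large degree, a vertex minimizing the ratio of weight and degree can be
deleted. -/
lemma HasPacking.of_large (h1 : ∀ v ∈ A, 1 ≤ (nbrs G A v).card)
    (h2 : ∀ v ∈ A, v ∉ X → 2 ≤ (nbrs G A v).card)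
    (hl : ∃ v ∈ A, (v ∈ X ∧ 3 ≤ (nbrs G A v).card) ∨ (v ∉ X ∧ 4 ≤ (nbrs G A v).card))
    (ih : ∀ B ⊂ A, HasPacking G (1 / 6) B X) : HasPacking G (1 / 6) A X := by
  obtain ⟨w, hw, hwd⟩ := hl
  obtain ⟨v, hv, hmin⟩ := Finset.exists_min_image A
    (fun v => weight (1 / 6) (v ∈ X) (nbrs G A v).card / (nbrs G A v).card) ⟨w, hw⟩
  refine HasPacking.of_erase hv (ih _ (Finset.erase_ssubset hv)) ?_
  -- The ratio is 1/(d(d+1)) ≤ 1/12 for a marked vertex and 2/(d(d+1)) ≤ 1/10 for an unmarked one.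
  -- The minimal ratio is thus below both terms of the minimum in `weight_gain`.
  have hw10 : weight (1 / 6) (w ∈ X) (nbrs G A w).card / (nbrs G A w).card ≤ 1 / 10 := by
    rcases hwd with ⟨hx, hd⟩ | ⟨hx, hd⟩
    · have : (3 : ℝ) ≤ (nbrs G A w).card := by exact_mod_cast hd
      rw [weight_marked hx, div_div, div_le_div_iff₀ (by positivity) (by norm_num)]
      nlinarith
    · have : (4 : ℝ) ≤ (nbrs G A w).card := by exact_mod_cast hd
      rw [weight_unmarked hx, starBound_sixth (by omega), div_div,
        div_le_div_iff₀ (by positivity) (by norm_num)]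
      nlinarith
  have hv10 := (hmin w hw).trans hw10
  have hvd : (0 : ℝ) < (nbrs G A v).card := by exact_mod_cast h1 v hv
  calc weight (1 / 6) (v ∈ X) (nbrs G A v).card
      = ∑ u ∈ nbrs G A v, weight (1 / 6) (v ∈ X) (nbrs G A v).card / (nbrs G A v).card := by
        rw [Finset.sum_const, nsmul_eq_mul]; field_simp
    _ ≤ _ := by
        refine Finset.sum_le_sum fun u hu => ?_
        have hu' := (mem_nbrs.1 hu).1
        exact (le_min hv10 (hmin u hu')).trans (weight_gain (h1 u hu') (h2 u hu'))

/-- The cost of deleting a vertex, in units of `1 / 30`, without its edges inside the deleted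
set. -/
def cost (G : SimpleGraph V) [DecidableRel G.Adj] (A X : Finset V) (v : V) : ℕ :=
  if v ∈ X then (if (nbrs G A v).card = 1 then 12 else 4)
  else (if (nbrs G A v).card = 2 then 12 else 6)

/-- The part d/10 is split off because edges leaving the deleted set are repaid by the survivors.
What is left is 1/2-1/10 and 1/3-2/10 for marked vertices, 3/5-2/10 and 1/2-3/10 for unmarked ones.
-/
lemma cost_eq (hA : SmallDegrees G A X) {v : V} (hv : v ∈ A) :
    weight (1 / 6) (v ∈ X) (nbrs G A v).card =
      (cost G A X v : ℝ) / 30 + ((nbrs G A v).card : ℝ) / 10 := by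
  obtain ⟨h1, h2, h3⟩ := hA v hv
  by_cases hx : v ∈ X
  · rw [weight_marked hx]
    simp only [cost, hx, if_true]
    rcases (by have := h2 hx; omega : (nbrs G A v).card = 1 ∨ (nbrs G A v).card = 2) with h | h <;>
      rw [h] <;> norm_num
  · rw [weight_unmarked hx]
    simp only [cost, hx, if_false]
    rcases (by have := h3 hx; omega : (nbrs G A v).card = 2 ∨ (nbrs G A v).card = 3) with h | h <;>
      rw [h] <;> norm_num [starBound_sixth_two, starBound_sixth_three]

lemma sum_toFinset_le (l : List V) (f : V → ℕ) : ∑ v ∈ l.toFinset, f v ≤ (l.map f).sum := by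
  induction l with
  | nil => simp
  | cons a l ih =>
    rw [List.toFinset_cons, List.map_cons, List.sum_cons]
    by_cases h : a ∈ l.toFinset
    · rw [Finset.insert_eq_of_mem h]; omega
    · rw [Finset.sum_insert h]; omega

lemma card_nbrs_toFinset_le {l : List V} {v : V} (m : List V)
    (h : ∀ u ∈ l, G.Adj v u → u ∈ m) : (nbrs G l.toFinset v).card ≤ m.length := by
  refine (Finset.card_le_card (t := m.toFinset) fun u hu => ?_).trans (List.toFinset_card_le m)
  simp only [mem_nbrs, List.mem_toFinset] at hu ⊢
  exact h u hu.1 hu.2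

/-- The working form of `HasPacking.reduce`, in units of 1/30: each deleted vertex pays its cost
plus 3 per neighbour inside the deleted set, and each chosen vertex earns 30. Repetitions in `D`
only overcount the payment, so coincidences among discarded vertices need no separate treatment. -/
lemma HasPacking.reduce_list (hA : SmallDegrees G A X)
    (ih : ∀ B ⊂ A, HasPacking G (1 / 6) B X) (C L D : List V)
    (hnd : (C ++ L).Nodup) (hne : C ++ L ++ D ≠ []) (hsub : ∀ t ∈ C ++ L ++ D, t ∈ A)
    (hC : ∀ u ∈ C, ∀ v ∈ C, ¬ G.Adj u v) (hL : ∀ u ∈ L, ∀ v ∈ L, ¬ G.Adj u v)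
    (hu : ∀ l ∈ L, ∀ c ∈ C, ∀ c' ∈ C, G.Adj l c → G.Adj l c' → c = c')
    (hX : ∀ l ∈ L, l ∉ X)
    (hn : ∀ s ∈ C ++ L, ∀ u ∈ A, G.Adj s u → u ∈ C ++ L ++ D)
    (hw : ((C ++ L ++ D).map fun t => cost G A X t +
      3 * (nbrs G (C ++ L ++ D).toFinset t).card).sum ≤ 30 * (C.length + L.length)) :
    HasPacking G (1 / 6) A X := by
  have hT : (C ++ L ++ D).toFinset ⊆ A := fun t ht => hsub t (List.mem_toFinset.1 ht)
  have hlen : (C.toFinset.card : ℝ) + L.toFinset.card = ((C.length + L.length : ℕ) : ℝ) := by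
    rw [List.nodup_append] at hnd
    rw [List.toFinset_card_of_nodup hnd.1, List.toFinset_card_of_nodup hnd.2.1]
    push_cast; rfl
  refine HasPacking.reduce (T := (C ++ L ++ D).toFinset) (C₀ := C.toFinset) (L₀ := L.toFinset)
    hA hT (fun t ht => by simp_all) (fun t ht => by simp_all) ⟨?_, ?_, ?_, ?_⟩ ?_ ?_
    (ih _ (Finset.sdiff_ssubset hT ((List.toFinset_nonempty_iff _).2 hne))) ?_
  · rw [List.nodup_append] at hnd
    rw [Finset.disjoint_left]
    intro t h1 h2
    exact hnd.2.2 t (List.mem_toFinset.1 h1) t (List.mem_toFinset.1 h2) rfl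
  · simpa using hC
  · simpa using hL
  · simpa using hu
  · rw [Finset.disjoint_left]; simpa using hX
  · intro s hs u hu
    rw [mem_nbrs] at hu
    rw [List.mem_toFinset]
    exact hn s (by simpa using hs) u hu.1 hu.2
  · rw [hlen]
    have h := (sum_toFinset_le (C ++ L ++ D) fun t => cost G A X t +
      3 * (nbrs G (C ++ L ++ D).toFinset t).card).trans hw
    have h' : ((∑ t ∈ (C ++ L ++ D).toFinset, (cost G A X t +
      3 * (nbrs G (C ++ L ++ D).toFinset t).card) : ℕ) : ℝ) ≤
        ((30 * (C.length + L.length) : ℕ) : ℝ) := by exact_mod_cast h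
    rw [Nat.cast_mul, Nat.cast_sum] at h'
    have e : ∑ t ∈ (C ++ L ++ D).toFinset, (weight (1 / 6) (t ∈ X) (nbrs G A t).card -
      ((nbrs G A t).card - (nbrs G (C ++ L ++ D).toFinset t).card : ℝ) / 10) =
      (∑ t ∈ (C ++ L ++ D).toFinset, ((cost G A X t +
        3 * (nbrs G (C ++ L ++ D).toFinset t).card : ℕ) : ℝ)) / 30 := by
      rw [Finset.sum_div]
      refine Finset.sum_congr rfl fun t ht => ?_
      rw [cost_eq hA (hT ht)]; push_cast; ring
    rw [e, div_le_iff₀ (by norm_num)]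
    push_cast at h' ⊢
    linarith

end rules

/-! ### Naming the neighbours of a vertex of small degree. -/

section neighbours

variable {V : Type u} {G : SimpleGraph V} [DecidableRel G.Adj] {A X : Finset V} {v x y : V}

lemma exists_first (hd : 1 ≤ (nbrs G A v).card) : ∃ x ∈ A, G.Adj v x := by
  obtain ⟨x, hx⟩ := Finset.card_pos.1 hd
  exact ⟨x, (mem_nbrs.1 hx).1, (mem_nbrs.1 hx).2⟩

lemma only_first (hd : (nbrs G A v).card = 1) (hx : x ∈ A) (hvx : G.Adj v x) :
    ∀ u ∈ A, G.Adj v u → u = x := by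
  intro u hu h
  exact Finset.card_le_one.1 hd.le u (mem_nbrs.2 ⟨hu, h⟩) x (mem_nbrs.2 ⟨hx, hvx⟩)

variable [DecidableEq V]

lemma exists_second (hd : (nbrs G A v).card = 2) (hx : x ∈ A) (hvx : G.Adj v x) :
    ∃ z ∈ A, G.Adj v z ∧ z ≠ x ∧ ∀ u ∈ A, G.Adj v u → u = x ∨ u = z := by
  have hx' : x ∈ nbrs G A v := mem_nbrs.2 ⟨hx, hvx⟩
  have h1 : ((nbrs G A v).erase x).card = 1 := by rw [Finset.card_erase_of_mem hx', hd]
  obtain ⟨z, hz⟩ := Finset.card_eq_one.1 h1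
  have hz' : ∀ u, (u ≠ x ∧ u ∈ A ∧ G.Adj v u) ↔ u = z := fun u => by
    rw [← mem_nbrs, ← Finset.mem_erase, hz, Finset.mem_singleton]
  obtain ⟨h2, h3, h4⟩ := (hz' z).2 rfl
  refine ⟨z, h3, h4, h2, fun u hu h => ?_⟩
  by_cases hux : u = x
  · exact Or.inl hux
  · exact Or.inr ((hz' u).1 ⟨hux, hu, h⟩)

lemma exists_third (hd : (nbrs G A v).card = 3) (hx : x ∈ A) (hvx : G.Adj v x) (hy : y ∈ A)
    (hvy : G.Adj v y) (hxy : x ≠ y) : ∃ z ∈ A, G.Adj v z ∧ z ≠ x ∧ z ≠ y ∧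
      ∀ u ∈ A, G.Adj v u → u = x ∨ u = y ∨ u = z := by
  have hx' : x ∈ nbrs G A v := mem_nbrs.2 ⟨hx, hvx⟩
  have hy' : y ∈ (nbrs G A v).erase x := Finset.mem_erase.2 ⟨hxy.symm, mem_nbrs.2 ⟨hy, hvy⟩⟩
  have h1 : (((nbrs G A v).erase x).erase y).card = 1 := by
    rw [Finset.card_erase_of_mem hy', Finset.card_erase_of_mem hx', hd]
  obtain ⟨z, hz⟩ := Finset.card_eq_one.1 h1
  have hz' : ∀ u, (u ≠ y ∧ u ≠ x ∧ u ∈ A ∧ G.Adj v u) ↔ u = z := fun u => by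
    rw [← mem_nbrs, ← Finset.mem_erase, ← Finset.mem_erase, hz, Finset.mem_singleton]
  obtain ⟨h2, h2', h3, h4⟩ := (hz' z).2 rfl
  refine ⟨z, h3, h4, h2', h2, fun u hu h => ?_⟩
  by_cases hux : u = x
  · exact Or.inl hux
  · by_cases huy : u = y
    · exact Or.inr (Or.inl huy)
    · exact Or.inr (Or.inr ((hz' u).1 ⟨huy, hux, hu, h⟩))

lemma exists_two (hd : 3 ≤ (nbrs G A v).card) (hx : x ∈ A) (hvx : G.Adj v x) :
    ∃ y ∈ A, G.Adj v y ∧ y ≠ x := by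
  have hx' : x ∈ nbrs G A v := mem_nbrs.2 ⟨hx, hvx⟩
  have h1 : 0 < ((nbrs G A v).erase x).card := by rw [Finset.card_erase_of_mem hx']; omega
  obtain ⟨y, hy⟩ := Finset.card_pos.1 h1
  rw [Finset.mem_erase, mem_nbrs] at hy
  exact ⟨y, hy.2.1, hy.2.2, hy.1⟩

lemma cost_marked_one (hx : v ∈ X) (hd : (nbrs G A v).card = 1) : cost G A X v = 12 := by
  simp [cost, hx, hd]
lemma cost_marked_two (hx : v ∈ X) (hd : (nbrs G A v).card = 2) : cost G A X v = 4 := by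
  simp [cost, hx, hd]
lemma cost_three (hx : v ∉ X) (hd : (nbrs G A v).card = 3) : cost G A X v = 6 := by
  simp [cost, hx, hd]

end neighbours

/-! ### Eliminating marked vertices. -/

section marked

variable {V : Type u} [DecidableEq V] {G : SimpleGraph V} [DecidableRel G.Adj] {A X : Finset V}

/-- Deleting a vertex with sufficiently many unmarked neighbours of degree two. -/
lemma HasPacking.of_erase_small (hA : SmallDegrees G A X)
    (ih : ∀ B ⊂ A, HasPacking G (1 / 6) B X) {v : V} (hv : v ∈ A)
    (hc : cost G A X v ≤
      4 * ((nbrs G A v).filter fun u => u ∉ X ∧ (nbrs G A u).card = 2).card) :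
    HasPacking G (1 / 6) A X := by
  refine HasPacking.of_erase hv (ih _ (Finset.erase_ssubset hv)) ?_
  -- An unmarked neighbour of degree two rises from 3/5 to 5/6, which is 2/15 = 4/30 above the
  -- guaranteed 1/10.
  have h : ∑ u ∈ nbrs G A v, ((1 / 10 : ℝ) +
      if u ∉ X ∧ (nbrs G A u).card = 2 then 2 / 15 else 0) ≤ ∑ u ∈ nbrs G A v,
      (weight (1 / 6) (u ∈ X) ((nbrs G A u).card - 1) -
        weight (1 / 6) (u ∈ X) (nbrs G A u).card) := by
    refine Finset.sum_le_sum fun u hu => ?_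
    have hu' := (mem_nbrs.1 hu).1
    obtain ⟨h1, h2, h3⟩ := hA u hu'
    split_ifs with h
    · rw [h.2, weight_unmarked h.1, weight_unmarked h.1, starBound_sixth_two, starBound_sixth_one]
      norm_num
    · have := weight_gain_small h1 h2 h3 (Nat.sub_le _ 1)
      rw [Nat.cast_sub h1] at this
      push_cast at this
      linarith
  refine le_trans ?_ h
  rw [cost_eq hA hv, Finset.sum_add_distrib, ← Finset.sum_filter, Finset.sum_const,
    Finset.sum_const, nsmul_eq_mul, nsmul_eq_mul]
  have hc' : (cost G A X v : ℝ) ≤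
      4 * ((nbrs G A v).filter fun u => u ∉ X ∧ (nbrs G A u).card = 2).card := by
    exact_mod_cast hc
  linarith

/-- Keep `x` as an isolated vertex and discard its neighbour; the payment is at most (12+3)+(12+3) =
30. -/
lemma HasPacking.of_marked_one (hA : SmallDegrees G A X)
    (ih : ∀ B ⊂ A, HasPacking G (1 / 6) B X) {x : V} (hx : x ∈ A) (hxX : x ∈ X)
    (hd : (nbrs G A x).card = 1) : HasPacking G (1 / 6) A X := by
  obtain ⟨u, hu, hxu⟩ := exists_first hd.ge
  have hxn := only_first hd hu hxu
  refine HasPacking.reduce_list hA ih [x] [] [u] (by simp) (by simp) (by simp [hx, hu]) (by simp)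
    (by simp) (by simp) (by simp) (by simpa using fun v hv h => Or.inr (hxn v hv h)) ?_
  have e1 : (nbrs G [x, u].toFinset x).card ≤ 1 :=
    card_nbrs_toFinset_le [u] (by simp)
  have e2 : (nbrs G [x, u].toFinset u).card ≤ 1 :=
    card_nbrs_toFinset_le [x] (by simp)
  have c1 : cost G A X x = 12 := cost_marked_one hxX hd
  have c2 : cost G A X u ≤ 12 := by unfold cost; split_ifs <;> omega
  simp at *
  omega

/-- If `x` has an unmarked neighbour of degree two, deleting `x` (cost 4) is free. Otherwise both
neighbours cost at most 6, and `x` is kept, either alone or with one neighbour as a leaf. -/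
lemma HasPacking.of_marked_two (hA : SmallDegrees G A X)
    (hm : ∀ v ∈ A, v ∈ X → (nbrs G A v).card = 2)
    (ih : ∀ B ⊂ A, HasPacking G (1 / 6) B X) {x : V} (hx : x ∈ A) (hxX : x ∈ X) :
    HasPacking G (1 / 6) A X := by
  obtain ⟨u, hu, hxu⟩ := exists_first (hA x hx).1
  obtain ⟨w, hw, hxw, hwu, hxn⟩ := exists_second (hm x hx hxX) hu hxu
  have hdel : ∀ u ∈ A, G.Adj x u → u ∉ X → (nbrs G A u).card = 2 →
      HasPacking G (1 / 6) A X := by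
    intro u hu hxu huX hud
    refine HasPacking.of_erase_small hA ih hx ?_
    have : 0 < ((nbrs G A x).filter fun u => u ∉ X ∧ (nbrs G A u).card = 2).card :=
      Finset.card_pos.2 ⟨u, Finset.mem_filter.2 ⟨mem_nbrs.2 ⟨hu, hxu⟩, huX, hud⟩⟩
    rw [cost_marked_two hxX (hm x hx hxX)]
    omega
  by_cases h1 : u ∉ X ∧ (nbrs G A u).card = 2
  · exact hdel u hu hxu h1.1 h1.2
  by_cases h2 : w ∉ X ∧ (nbrs G A w).card = 2
  · exact hdel w hw hxw h2.1 h2.2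
  have cx : cost G A X x = 4 := cost_marked_two hxX (hm x hx hxX)
  have hc : ∀ v ∈ A, ¬ (v ∉ X ∧ (nbrs G A v).card = 2) → cost G A X v ≤ 6 := by
    intro v hv h
    by_cases hvX : v ∈ X
    · rw [cost_marked_two hvX (hm v hv hvX)]; omega
    · have := (hA v hv).2.2 hvX
      rw [cost_three hvX (by simp [hvX] at h; omega)]
  by_cases huw : G.Adj u w
  -- In a triangle with `u` unmarked of degree three, keep the edge `xu`: the payment is at most
  -- 10+15+15+18 = 58 ≤ 60.
  · have hadj : ∀ u ∈ A, ∀ w ∈ A, G.Adj x u → G.Adj x w → w ≠ u → G.Adj u w → 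
        (∀ v ∈ A, G.Adj x v → v = u ∨ v = w) → u ∉ X → (nbrs G A u).card = 3 → 
        cost G A X w ≤ 6 → HasPacking G (1 / 6) A X := by
      intro u hu w hw hxu hxw hwu huw hxn huX hud hcw
      obtain ⟨u', hu', huu', hne1, hne2, hun⟩ := exists_third hud hx hxu.symm hw huw hxw.ne
      refine HasPacking.reduce_list hA ih [x] [u] [w, u'] (by simp [hxu.ne]) (by simp)
        (by simp [hx, hu, hw, hu']) (by simp) (by simp) (by simp) (by simp [huX]) ?_ ?_
      · simp; grind
      have e1 : (nbrs G [x, u, w, u'].toFinset x).card ≤ 2 :=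
        card_nbrs_toFinset_le [u, w] (by simp; grind)
      have e2 : (nbrs G [x, u, w, u'].toFinset u).card ≤ 3 :=
        card_nbrs_toFinset_le [x, w, u'] (by simp)
      have e3 : (nbrs G [x, u, w, u'].toFinset w).card ≤ 3 :=
        card_nbrs_toFinset_le [x, u, u'] (by simp)
      have e4 : (nbrs G [x, u, w, u'].toFinset u').card ≤ 2 :=
        card_nbrs_toFinset_le [u, w] (by
          simp only [List.mem_cons]; clear ih; grind [SimpleGraph.Adj.symm, SimpleGraph.Adj.ne])
      have c1 := cost_three huX hud
      have c2 : cost G A X u' ≤ 12 := by unfold cost; split_ifs <;> omega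
      simp at *
      omega
    by_cases huX : u ∈ X
    · by_cases hwX : w ∈ X
      -- All three vertices of the triangle are marked of degree two, so it pays exactly 3·10 = 30.
      · refine HasPacking.reduce_list hA ih [x] [] [u, w] (by simp) (by simp)
          (by simp [hx, hu, hw]) (by simp) (by simp) (by simp) (by simp) ?_ ?_
        · simp; grind
        have e1 : (nbrs G [x, u, w].toFinset x).card ≤ 2 :=
          card_nbrs_toFinset_le [u, w] (by simp)
        have e2 : (nbrs G [x, u, w].toFinset u).card ≤ 2 :=
          card_nbrs_toFinset_le [x, w] (by simp)
        have e3 : (nbrs G [x, u, w].toFinset w).card ≤ 2 :=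
          card_nbrs_toFinset_le [x, u] (by simp)
        have c1 := cost_marked_two huX (hm u hu huX)
        have c2 := cost_marked_two hwX (hm w hw hwX)
        simp at *
        omega
      · have := (hA w hw).2.2 hwX
        exact hadj w hw u hu hxw hxu hwu.symm huw.symm (fun v hv h => (hxn v hv h).symm) hwX
          (by simp [hwX] at h2; omega) (hc u hu h1)
    · have := (hA u hu).2.2 huX
      exact hadj u hu w hw hxu hxw hwu huw hxn huX (by simp [huX] at h1; omega) (hc w hw h2)
  -- Without the edge `uw` the payment is at most 10+9+9 = 28.
  · refine HasPacking.reduce_list hA ih [x] [] [u, w] (by simp) (by simp)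
      (by simp [hx, hu, hw]) (by simp) (by simp) (by simp) (by simp) ?_ ?_
    · simp; grind
    have e1 : (nbrs G [x, u, w].toFinset x).card ≤ 2 :=
      card_nbrs_toFinset_le [u, w] (by simp)
    have e2 : (nbrs G [x, u, w].toFinset u).card ≤ 1 :=
      card_nbrs_toFinset_le [x] (by simp [huw])
    have e3 : (nbrs G [x, u, w].toFinset w).card ≤ 1 :=
      card_nbrs_toFinset_le [x] (by simp [G.adj_comm w u, huw])
    have c1 := hc u hu h1
    have c2 := hc w hw h2
    simp at *
    omega

end marked

/-! ### Minimal counterexamples: around a vertex of degree two. -/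

section unmarked

variable {V : Type u} {G : SimpleGraph V} [DecidableRel G.Adj] {A X : Finset V}

/-- `v` has exactly the two neighbours `x` and `y` in `A`. -/
structure Nbrs2 (G : SimpleGraph V) [DecidableRel G.Adj] (A : Finset V) (v x y : V) : Prop where
  mem : v ∈ A
  card : (nbrs G A v).card = 2
  memx : x ∈ A
  memy : y ∈ A
  adjx : G.Adj v x
  adjy : G.Adj v y
  ne : x ≠ y
  only : ∀ u ∈ A, G.Adj v u → u = x ∨ u = y

/-- `v` has exactly the three neighbours `x`, `y` and `z` in `A`. -/
structure Nbrs3 (G : SimpleGraph V) [DecidableRel G.Adj] (A : Finset V) (v x y z : V) :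
    Prop where
  mem : v ∈ A
  card : (nbrs G A v).card = 3
  memx : x ∈ A
  memy : y ∈ A
  memz : z ∈ A
  adjx : G.Adj v x
  adjy : G.Adj v y
  adjz : G.Adj v z
  nexy : x ≠ y
  nexz : x ≠ z
  neyz : y ≠ z
  only : ∀ u ∈ A, G.Adj v u → u = x ∨ u = y ∨ u = z

lemma Nbrs2.swap {v x y : V} (h : Nbrs2 G A v x y) : Nbrs2 G A v y x :=
  ⟨h.mem, h.card, h.memy, h.memx, h.adjy, h.adjx, h.ne.symm, fun u hu h' => (h.only u hu h').symm⟩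

lemma Nbrs3.swap {v x y z : V} (h : Nbrs3 G A v x y z) : Nbrs3 G A v x z y :=
  ⟨h.mem, h.card, h.memx, h.memz, h.memy, h.adjx, h.adjz, h.adjy, h.nexz, h.nexy, h.neyz.symm,
    fun u hu h' => (h.only u hu h').imp_right Or.symm⟩

/-- A third of the cost of an unmarked vertex. -/
def unit (G : SimpleGraph V) [DecidableRel G.Adj] (A : Finset V) (v : V) : ℕ :=
  if (nbrs G A v).card = 2 then 4 else 2

lemma unit_two {v : V} (h : (nbrs G A v).card = 2) : unit G A v = 4 := if_pos h

lemma unit_three {v : V} (h : (nbrs G A v).card = 3) : unit G A v = 2 := if_neg (by omega)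

variable [DecidableEq V]

lemma exists_nbrs2 {v x : V} (hv : v ∈ A) (hd : (nbrs G A v).card = 2) (hx : x ∈ A)
    (hvx : G.Adj v x) : ∃ y, Nbrs2 G A v x y := by
  obtain ⟨y, hy, h1, h2, h3⟩ := exists_second hd hx hvx
  exact ⟨y, hv, hd, hx, hy, hvx, h1, h2.symm, h3⟩

lemma exists_nbrs3 {v x y : V} (hv : v ∈ A) (hd : (nbrs G A v).card = 3) (hx : x ∈ A)
    (hvx : G.Adj v x) (hy : y ∈ A) (hvy : G.Adj v y) (hxy : x ≠ y) :
    ∃ z, Nbrs3 G A v x y z := by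
  obtain ⟨z, hz, h1, h2, h3, h4⟩ := exists_third hd hx hvx hy hvy hxy
  exact ⟨z, hv, hd, hx, hy, hz, hvx, hvy, h1, hxy, h2.symm, h3.symm, h4⟩

lemma exists_nbrs3' {v x : V} (hv : v ∈ A) (hd : (nbrs G A v).card = 3) (hx : x ∈ A)
    (hvx : G.Adj v x) : ∃ y z, Nbrs3 G A v x y z := by
  obtain ⟨y, hy, h1, h2⟩ := exists_two hd.ge hx hvx
  exact ⟨y, exists_nbrs3 hv hd hx hvx hy h1 h2.symm⟩

lemma card_nbrs_toFinset_le_card {l : List V} (hl : ∀ t ∈ l, t ∈ A) (v : V) :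
    (nbrs G l.toFinset v).card ≤ (nbrs G A v).card :=
  Finset.card_le_card (Finset.filter_subset_filter _ fun t ht => hl t (List.mem_toFinset.1 ht))

/-- A minimal counterexample without marked vertices and with degrees two and three. -/
structure Irreducible (G : SimpleGraph V) [DecidableRel G.Adj] (A X : Finset V) : Prop where
  small : SmallDegrees G A X
  unmarked : ∀ v ∈ A, v ∉ X
  ih : ∀ B ⊂ A, HasPacking G (1 / 6) B X
  not_packing : ¬ HasPacking G (1 / 6) A X

namespace Irreducible

lemma card_eq (h : Irreducible G A X) {v : V} (hv : v ∈ A) :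
    (nbrs G A v).card = 2 ∨ (nbrs G A v).card = 3 := by
  have := (h.small v hv).2.2 (h.unmarked v hv)
  omega

/-- The count of `reduce_list` divided by 3. A chosen vertex pays 4+2 = 6 for degree two and 2+3 = 5
for degree three, and earns 10; all reductions below are tallied in these units. -/
lemma absurd_of_lists (h : Irreducible G A X) (C L D : List V)
    (hsub : ∀ t ∈ C ++ L ++ D, t ∈ A)
    (hn : ∀ s ∈ C ++ L, ∀ u ∈ A, G.Adj s u → u ∈ C ++ L ++ D)
    (hnd : (C ++ L).Nodup) (hne : C ++ L ++ D ≠ [])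
    (hC : ∀ u ∈ C, ∀ v ∈ C, ¬ G.Adj u v) (hL : ∀ u ∈ L, ∀ v ∈ L, ¬ G.Adj u v)
    (hu : ∀ l ∈ L, ∀ c ∈ C, ∀ c' ∈ C, G.Adj l c → G.Adj l c' → c = c')
    (hw : ((C ++ L).map fun t => unit G A t + (nbrs G A t).card).sum + (D.map fun t => unit G A t +
      (nbrs G (C ++ L ++ D).toFinset t).card).sum ≤ 10 * (C.length + L.length)) : False := by
  refine h.not_packing (HasPacking.reduce_list h.small h.ih C L D hnd hne hsub hC hL hu
    (fun l hl => h.unmarked l (hsub l (by simp [hl]))) hn ?_)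
  have e : ((C ++ L ++ D).map fun t => cost G A X t +
      3 * (nbrs G (C ++ L ++ D).toFinset t).card) = (C ++ L ++ D).map fun t => 3 * (unit G A t +
      (nbrs G (C ++ L ++ D).toFinset t).card) := by
    refine List.map_congr_left fun t ht => ?_
    have := h.unmarked t (hsub t ht)
    simp only [cost, unit, this, if_false]
    split_ifs <;> ring
  have hS : ((C ++ L).map fun t => unit G A t + (nbrs G (C ++ L ++ D).toFinset t).card).sum ≤
      ((C ++ L).map fun t => unit G A t + (nbrs G A t).card).sum :=
    List.sum_le_sum fun t _ => Nat.add_le_add_left (card_nbrs_toFinset_le_card hsub t) _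
  rw [e, List.sum_map_mul_left, List.map_append, List.sum_append]
  omega

/-- With two neighbours of degree two, `a` could simply be deleted: its cost 6 is at most the extra
gain 4+4. -/
lemma card_eq_three (h : Irreducible G A X) {a y z : V} (ha : a ∈ A)
    (hd : (nbrs G A a).card = 3) (hy : y ∈ A) (hz : z ∈ A) (hyz : y ≠ z) (hay : G.Adj a y)
    (haz : G.Adj a z) (hyd : (nbrs G A y).card = 2) : (nbrs G A z).card = 3 := by
  refine (h.card_eq hz).resolve_left fun hzd => h.not_packing
    (HasPacking.of_erase_small h.small h.ih ha ?_)
  rw [cost_three (h.unmarked a ha) hd]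
  have : 1 < ((nbrs G A a).filter fun u => u ∉ X ∧ (nbrs G A u).card = 2).card := by
    refine Finset.one_lt_card.2 ⟨y, ?_, z, ?_, hyz⟩ <;>
      simp only [Finset.mem_filter, mem_nbrs]
    · exact ⟨⟨hy, hay⟩, h.unmarked y hy, hyd⟩
    · exact ⟨⟨hz, haz⟩, h.unmarked z hz, hzd⟩
  omega

lemma unit_add_le (h : Irreducible G A X) {l : List V} (hl : ∀ t ∈ l, t ∈ A) {v : V}
    (hv : v ∈ A) : unit G A v + (nbrs G l.toFinset v).card ≤ 6 := by
  have := card_nbrs_toFinset_le_card (G := G) hl v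
  rcases h.card_eq hv with hd | hd
  · rw [unit_two hd]; omega
  · rw [unit_three hd]; omega

/-- A vertex of degree two with two neighbours of degree two. -/
lemma not_two_two (h : Irreducible G A X) {y a b a' b' : V} (hy : Nbrs2 G A y a b)
    (ha : Nbrs2 G A a y a') (hb : Nbrs2 G A b y b') : False := by
  obtain ⟨y1, y2, y3, y4, y5, y6, y7, y8⟩ := hy
  obtain ⟨a1, a2, a3, a4, a5, a6, a7, a8⟩ := ha
  obtain ⟨b1, b2, b3, b4, b5, b6, b7, b8⟩ := hb
  by_cases hab : G.Adj a b
  · have hsub : ∀ t ∈ [y, a, b], t ∈ A := by simp [*]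
    refine h.absurd_of_lists [y] [a] [b] hsub ?_ (by simp [y5.ne]) (by simp)
      (by simp) (by simp) (by simp) ?_
    · simp only [List.cons_append, List.nil_append, List.mem_cons, List.not_mem_nil]
      grind [SimpleGraph.Adj.symm, SimpleGraph.Adj.ne]
    have := h.unit_add_le hsub b1
    have := unit_two y2
    have := unit_two a2
    simp only [List.cons_append, List.nil_append, List.map_cons, List.map_nil, List.sum_cons,
      List.sum_nil, List.length_cons, List.length_nil] at *
    omega
  -- Keep the path `a y b`: 18 for it and at most 6 for each of `a'`, `b'`.
  · have hsub : ∀ t ∈ [y, a, b, a', b'], t ∈ A := by simp [*]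
    refine h.absurd_of_lists [y] [a, b] [a', b'] hsub ?_ (by simp [y5.ne, y6.ne, y7]) (by simp)
      (by simp) (by simp [hab, G.adj_comm b a]) (by simp) ?_
    · simp only [List.cons_append, List.nil_append, List.mem_cons, List.not_mem_nil]
      grind [SimpleGraph.Adj.symm, SimpleGraph.Adj.ne]
    have := h.unit_add_le hsub a4
    have := h.unit_add_le hsub b4
    have := unit_two y2
    have := unit_two a2
    have := unit_two b2
    simp only [List.cons_append, List.nil_append, List.map_cons, List.map_nil, List.sum_cons,
      List.sum_nil, List.length_cons, List.length_nil] at *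
    omega

/-- Two adjacent vertices of degree two whose other neighbours have degree three. -/
lemma not_two_three (h : Irreducible G A X) {y a b a' : V} (hy : Nbrs2 G A y a b)
    (ha : Nbrs2 G A a y a') (hb : (nbrs G A b).card = 3) (ha' : (nbrs G A a').card = 3) :
    False := by
  obtain ⟨y1, y2, y3, y4, y5, y6, y7, y8⟩ := hy
  obtain ⟨a1, a2, a3, a4, a5, a6, a7, a8⟩ := ha
  have hsub : ∀ t ∈ [y, a, b, a'], t ∈ A := by simp [*]
  refine h.absurd_of_lists [y] [a] [b, a'] hsub ?_ (by simp [y5.ne]) (by simp)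
    (by simp) (by simp) (by simp) ?_
  · simp only [List.cons_append, List.nil_append, List.mem_cons, List.not_mem_nil]
    grind [SimpleGraph.Adj.symm, SimpleGraph.Adj.ne]
  have e1 : (nbrs G [y, a, b, a'].toFinset b).card ≤ 2 := by
    by_cases hba : b = a'
    · exact card_nbrs_toFinset_le [y, a] (by
        simp only [List.mem_cons, List.not_mem_nil]
        grind [SimpleGraph.Adj.symm, SimpleGraph.Adj.ne])
    · exact card_nbrs_toFinset_le [y, a'] (by
        simp only [List.mem_cons, List.not_mem_nil]
        grind [SimpleGraph.Adj.symm, SimpleGraph.Adj.ne])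
  have e2 : (nbrs G [y, a, b, a'].toFinset a').card ≤ 2 := by
    by_cases hba : b = a'
    · exact card_nbrs_toFinset_le [y, a] (by
        simp only [List.mem_cons, List.not_mem_nil]
        grind [SimpleGraph.Adj.symm, SimpleGraph.Adj.ne])
    · exact card_nbrs_toFinset_le [a, b] (by
        simp only [List.mem_cons, List.not_mem_nil]
        grind [SimpleGraph.Adj.symm, SimpleGraph.Adj.ne])
  have := unit_two y2
  have := unit_two a2
  have := unit_three hb
  have := unit_three ha'
  simp only [List.cons_append, List.nil_append, List.map_cons, List.map_nil, List.sum_cons,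
    List.sum_nil, List.length_cons, List.length_nil] at *
  omega

/-- The neighbours of a vertex of degree two have degree three. -/
lemma card_nbr (h : Irreducible G A X) {y a b : V} (hy : Nbrs2 G A y a b) :
    (nbrs G A a).card = 3 := by
  refine (h.card_eq hy.memx).resolve_left fun ha => ?_
  obtain ⟨a', ha'⟩ := exists_nbrs2 hy.memx ha hy.mem hy.adjx.symm
  rcases h.card_eq hy.memy with hb | hb
  · obtain ⟨b', hb'⟩ := exists_nbrs2 hy.memy hb hy.mem hy.adjy.symm
    exact h.not_two_two hy ha' hb'
  · rcases h.card_eq ha'.memy with hd | hd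
    · obtain ⟨c, hc⟩ := exists_nbrs2 ha'.memy hd ha'.mem ha'.adjy.symm
      exact h.not_two_two ha' ⟨hy.mem, hy.card, hy.memx, hy.memy, hy.adjx, hy.adjy, hy.ne,
        hy.only⟩ hc
    · exact h.not_two_three hy ha' hb hd

/-- The two neighbours of a vertex of degree two are not adjacent. -/
lemma not_adj_nbrs (h : Irreducible G A X) {y a b : V} (hy : Nbrs2 G A y a b) :
    ¬ G.Adj a b := by
  intro hab
  have hb := unit_three (h.card_nbr hy.swap)
  obtain ⟨a', ha'⟩ := exists_nbrs3 hy.memx (h.card_nbr hy) hy.mem hy.adjx.symm hy.memy hab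
    hy.adjy.ne
  have ua' := unit_three (h.card_eq_three hy.memx (h.card_nbr hy) hy.mem ha'.memz ha'.nexz
    hy.adjx.symm ha'.adjz hy.card)
  obtain ⟨h1, h2, h3, h4, h5, h6, h7, h8⟩ := hy
  obtain ⟨k1, k2, k3, k4, k5, k6, k7, k8, k9, k10, k11, k12⟩ := ha'
  -- Keep the edge `ay`: 5+6, then 5 for `b` and 4 for `a'`, which is not adjacent to `y`; total 20.
  refine h.absurd_of_lists [a] [y] [b, a'] (by simp [*]) ?_ (by simp [k6.ne]) (by simp)
    (by simp) (by simp) (by simp) ?_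
  · simp only [List.cons_append, List.nil_append, List.mem_cons, List.not_mem_nil]
    grind [SimpleGraph.Adj.symm, SimpleGraph.Adj.ne]
  have e3 : (nbrs G [a, y, b, a'].toFinset b).card ≤ 3 :=
    card_nbrs_toFinset_le [a, y, a'] (by
        simp only [List.mem_cons, List.not_mem_nil]
        grind [SimpleGraph.Adj.symm, SimpleGraph.Adj.ne])
  have e4 : (nbrs G [a, y, b, a'].toFinset a').card ≤ 2 :=
    card_nbrs_toFinset_le [a, b] (by
        simp only [List.mem_cons, List.not_mem_nil]
        grind [SimpleGraph.Adj.symm, SimpleGraph.Adj.ne])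
  have u1 := unit_two h2
  have u2 := unit_three k2
  simp only [List.cons_append, List.nil_append, List.map_cons, List.map_nil, List.sum_cons,
    List.sum_nil, List.length_cons, List.length_nil] at *
  omega

/-- The neighbours of a vertex of degree two have no other common neighbour. -/
lemma not_common (h : Irreducible G A X) {y a b c a₂ b₂ : V} (hy : Nbrs2 G A y a b)
    (ha : Nbrs3 G A a y c a₂) (hb : Nbrs3 G A b y c b₂) : False := by
  have hab := h.not_adj_nbrs hy
  have uc := unit_three (h.card_eq_three ha.mem ha.card ha.memx ha.memy ha.nexy ha.adjx ha.adjy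
    hy.card)
  have ua₂ := unit_three (h.card_eq_three ha.mem ha.card ha.memx ha.memz ha.nexz ha.adjx ha.adjz
    hy.card)
  have ub₂ := unit_three (h.card_eq_three hb.mem hb.card hb.memx hb.memz hb.nexz hb.adjx hb.adjz
    hy.card)
  obtain ⟨w, hw⟩ := exists_nbrs3 ha.memy (h.card_eq_three ha.mem ha.card ha.memx ha.memy ha.nexy
    ha.adjx ha.adjy hy.card) ha.mem ha.adjy.symm hb.mem hb.adjy.symm hy.ne
  have hwc := hw.only
  clear hw
  obtain ⟨y1, y2, y3, y4, y5, y6, y7, y8⟩ := hy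
  obtain ⟨a1, a2, a3, a4, a5, a6, a7, a8, a9, a10, a11, a12⟩ := ha
  obtain ⟨b1, b2, b3, b4, b5, b6, b7, b8, b9, b10, b11, b12⟩ := hb
  by_cases hab₂ : a₂ = b₂
  · have hsub : ∀ t ∈ [y, a, b, c, a₂], t ∈ A := by simp [*]
    refine h.absurd_of_lists [y] [a, b] [c, a₂] hsub ?_
      (by simp [y5.ne, y6.ne, y7]) (by simp) (by simp) (by simp [hab, G.adj_comm b a])
      (by simp) ?_
    · simp only [List.cons_append, List.nil_append, List.mem_cons, List.not_mem_nil]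
      grind [SimpleGraph.Adj.symm, SimpleGraph.Adj.ne]
    have := h.unit_add_le hsub a4
    have := h.unit_add_le hsub a5
    have := unit_two y2
    have := unit_three a2
    have := unit_three b2
    simp only [List.cons_append, List.nil_append, List.map_cons, List.map_nil, List.sum_cons,
      List.sum_nil, List.length_cons, List.length_nil] at *
    omega
  have hsub : ∀ t ∈ [y, a, b, c, a₂, b₂], t ∈ A := by simp [*]
  refine h.absurd_of_lists [y] [a, b] [c, a₂, b₂] hsub ?_
    (by simp [y5.ne, y6.ne, y7]) (by simp) (by simp) (by simp [hab, G.adj_comm b a]) (by simp) ?_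
  · simp only [List.cons_append, List.nil_append, List.mem_cons, List.not_mem_nil]
    grind [SimpleGraph.Adj.symm, SimpleGraph.Adj.ne]
  have e1 : (nbrs G [y, a, b, c, a₂, b₂].toFinset c).card ≤ 3 :=
    card_nbrs_toFinset_le [a, b, w] (by
        simp only [List.mem_cons, List.not_mem_nil]
        grind [SimpleGraph.Adj.symm, SimpleGraph.Adj.ne])
  -- The path `a y b` pays 16, leaving 14. Besides `a` and `b`, the vertex `c` has a single
  -- neighbour, so it cannot be adjacent to both `a₂` and `b₂`.
  have e2 : (nbrs G [y, a, b, c, a₂, b₂].toFinset a₂).card +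
      (nbrs G [y, a, b, c, a₂, b₂].toFinset b₂).card ≤ 5 := by
    by_cases hca : G.Adj c a₂
    · have e3 : (nbrs G [y, a, b, c, a₂, b₂].toFinset a₂).card ≤ 3 :=
        card_nbrs_toFinset_le [a, c, b₂] (by
            simp only [List.mem_cons, List.not_mem_nil]
            grind [SimpleGraph.Adj.symm, SimpleGraph.Adj.ne])
      have e4 : (nbrs G [y, a, b, c, a₂, b₂].toFinset b₂).card ≤ 2 :=
        card_nbrs_toFinset_le [b, a₂] (by
            simp only [List.mem_cons, List.not_mem_nil]
            grind [SimpleGraph.Adj.symm, SimpleGraph.Adj.ne])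
      omega
    · have e3 : (nbrs G [y, a, b, c, a₂, b₂].toFinset a₂).card ≤ 2 :=
        card_nbrs_toFinset_le [a, b₂] (by
            simp only [List.mem_cons, List.not_mem_nil]
            grind [SimpleGraph.Adj.symm, SimpleGraph.Adj.ne])
      have e4 : (nbrs G [y, a, b, c, a₂, b₂].toFinset b₂).card ≤ 3 :=
        card_nbrs_toFinset_le [b, c, a₂] (by
            simp only [List.mem_cons, List.not_mem_nil]
            grind [SimpleGraph.Adj.symm, SimpleGraph.Adj.ne])
      omega
  have := unit_two y2
  have := unit_three a2
  have := unit_three b2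
  simp only [List.cons_append, List.nil_append, List.map_cons, List.map_nil, List.sum_cons,
    List.sum_nil, List.length_cons, List.length_nil] at *
  omega

end Irreducible

end unmarked

/-! ### Minimal counterexamples: no vertex of degree two. -/

section bridge

variable {V : Type u} {G : SimpleGraph V} [DecidableRel G.Adj] {A X : Finset V}

/-- A vertex `y` of degree two, its neighbours `a` and `b`, and their other neighbours. -/
structure Bridge (G : SimpleGraph V) [DecidableRel G.Adj] (A : Finset V)
    (y a b a₁ a₂ b₁ b₂ : V) : Prop where
  nbrsy : Nbrs2 G A y a b
  nbrsa : Nbrs3 G A a y a₁ a₂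
  nbrsb : Nbrs3 G A b y b₁ b₂

variable {y a b a₁ a₂ b₁ b₂ : V}

lemma Bridge.swapa (h : Bridge G A y a b a₁ a₂ b₁ b₂) : Bridge G A y a b a₂ a₁ b₁ b₂ :=
  ⟨h.nbrsy, h.nbrsa.swap, h.nbrsb⟩

lemma Bridge.swapb (h : Bridge G A y a b a₁ a₂ b₁ b₂) : Bridge G A y a b a₁ a₂ b₂ b₁ :=
  ⟨h.nbrsy, h.nbrsa, h.nbrsb.swap⟩

lemma Bridge.swap (h : Bridge G A y a b a₁ a₂ b₁ b₂) : Bridge G A y b a b₁ b₂ a₁ a₂ :=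
  ⟨h.nbrsy.swap, h.nbrsb, h.nbrsa⟩

variable [DecidableEq V]

namespace Irreducible

lemma exists_bridge (h : Irreducible G A X) (hy : y ∈ A) (hd : (nbrs G A y).card = 2) :
    ∃ a b a₁ a₂ b₁ b₂, Bridge G A y a b a₁ a₂ b₁ b₂ := by
  obtain ⟨a, ha, hya⟩ := exists_first (by omega : 1 ≤ (nbrs G A y).card)
  obtain ⟨b, hyab⟩ := exists_nbrs2 hy hd ha hya
  obtain ⟨a₁, a₂, h₁⟩ := exists_nbrs3' ha (h.card_nbr hyab) hy hya.symm
  obtain ⟨b₁, b₂, h₂⟩ := exists_nbrs3' hyab.memy (h.card_nbr hyab.swap) hy hyab.adjy.symm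
  exact ⟨a, b, a₁, a₂, b₁, b₂, hyab, h₁, h₂⟩

lemma bridge_facts (h : Irreducible G A X) (hB : Bridge G A y a b a₁ a₂ b₁ b₂) :
    ¬ G.Adj a b ∧ (a₁ ≠ b₁ ∧ a₁ ≠ b₂ ∧ a₂ ≠ b₁ ∧ a₂ ≠ b₂) ∧
      (nbrs G A a₁).card = 3 ∧ (nbrs G A a₂).card = 3 ∧ (nbrs G A b₁).card = 3 ∧
        (nbrs G A b₂).card = 3 := by
  have h3 : ∀ {v x z}, Nbrs3 G A v y x z → (nbrs G A x).card = 3 := fun hv =>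
    h.card_eq_three hv.mem hv.card hv.memx hv.memy hv.nexy hv.adjx hv.adjy hB.nbrsy.card
  refine ⟨h.not_adj_nbrs hB.nbrsy, ⟨?_, ?_, ?_, ?_⟩, h3 hB.nbrsa, h3 hB.nbrsa.swap, h3 hB.nbrsb,
    h3 hB.nbrsb.swap⟩
  · rintro rfl; exact h.not_common hB.nbrsy hB.nbrsa hB.nbrsb
  · rintro rfl; exact h.not_common hB.nbrsy hB.nbrsa hB.nbrsb.swap
  · rintro rfl; exact h.not_common hB.nbrsy hB.nbrsa.swap hB.nbrsb
  · rintro rfl; exact h.not_common hB.nbrsy hB.nbrsa.swap hB.nbrsb.swap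

/-- If `a₁` and `a₂` were adjacent, one could keep the star at `a` with leaves `y`, `a₁`. It pays
16, and the discarded `b`, `a₂` and third neighbour `w` of `a₁` pay at most 14 together. -/
lemma bridge_not_adj (h : Irreducible G A X) (hB : Bridge G A y a b a₁ a₂ b₁ b₂) :
    ¬ G.Adj a₁ a₂ := by
  intro ha₁₂
  obtain ⟨hab, ⟨n1, n2, n3, n4⟩, d1, d2, d3, d4⟩ := h.bridge_facts hB
  obtain ⟨w, hw⟩ := exists_nbrs3 hB.nbrsa.memy d1 hB.nbrsa.mem hB.nbrsa.adjy.symm hB.nbrsa.memz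
    ha₁₂ hB.nbrsa.adjz.ne
  have hwd := h.card_eq hw.memz
  obtain ⟨⟨y1, y2, y3, y4, y5, y6, y7, y8⟩, ⟨-, y10, -, a1, a2, -, a3, a4, a5, a6, a7, a8⟩,
    ⟨-, y11, -, b1, b2, -, b3, b4, b5, b6, b7, b8⟩⟩ := hB
  obtain ⟨w1, w2, w3, w4, w5, w6, w7, w8, w9, w10, w11, w12⟩ := hw
  have hsub : ∀ t ∈ [a, y, a₁, b, a₂, w], t ∈ A := by simp [*]
  refine h.absurd_of_lists [a] [y, a₁] [b, a₂, w] hsub ?_ (by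
      simp only [List.cons_append, List.nil_append, List.nodup_cons, List.mem_cons,
        List.not_mem_nil, List.nodup_nil]; grind [SimpleGraph.Adj.symm, SimpleGraph.Adj.ne]) (by simp)
    (by simp) ?_ (by simp) ?_
  · simp only [List.cons_append, List.nil_append, List.mem_cons, List.not_mem_nil]
    grind [SimpleGraph.Adj.symm, SimpleGraph.Adj.ne]
  · simp only [List.mem_cons, List.not_mem_nil]; grind [SimpleGraph.Adj.symm, SimpleGraph.Adj.ne]
  have e1 : unit G A b + (nbrs G [a, y, a₁, b, a₂, w].toFinset b).card + unit G A w +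
      (nbrs G [a, y, a₁, b, a₂, w].toFinset w).card + unit G A a₂ +
      (nbrs G [a, y, a₁, b, a₂, w].toFinset a₂).card ≤ 14 := by
    rw [unit_three y11, unit_three d2]
    rcases hwd with hwd | hwd
    · obtain ⟨w', hw'⟩ := exists_nbrs2 w5 hwd w1 w8.symm
      have hw'o := hw'.only
      clear hw'
      have := h.unit_add_le hsub w5
      by_cases hbw : G.Adj b w
      · have := card_nbrs_toFinset_le (G := G) (l := [a, y, a₁, b, a₂, w]) (v := b) [y, w] (by
          simp only [List.mem_cons, List.not_mem_nil]
          grind [SimpleGraph.Adj.symm, SimpleGraph.Adj.ne])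
        have := card_nbrs_toFinset_le (G := G) (l := [a, y, a₁, b, a₂, w]) (v := a₂) [a, a₁] (by
          simp only [List.mem_cons, List.not_mem_nil]
          grind [SimpleGraph.Adj.symm, SimpleGraph.Adj.ne])
        simp only [List.length_cons, List.length_nil] at *
        omega
      · have := card_nbrs_toFinset_le (G := G) (l := [a, y, a₁, b, a₂, w]) (v := b) [y] (by
          simp only [List.mem_cons, List.not_mem_nil]
          grind [SimpleGraph.Adj.symm, SimpleGraph.Adj.ne])
        have := card_nbrs_toFinset_le (G := G) (l := [a, y, a₁, b, a₂, w]) (v := a₂) [a, a₁, w]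
          (by
          simp only [List.mem_cons, List.not_mem_nil]
          grind [SimpleGraph.Adj.symm, SimpleGraph.Adj.ne])
        simp only [List.length_cons, List.length_nil] at *
        omega
    · rw [unit_three hwd]
      have := card_nbrs_toFinset_le (G := G) (l := [a, y, a₁, b, a₂, w]) (v := b) [y, w] (by
          simp only [List.mem_cons, List.not_mem_nil]
          grind [SimpleGraph.Adj.symm, SimpleGraph.Adj.ne])
      have := card_nbrs_toFinset_le (G := G) (l := [a, y, a₁, b, a₂, w]) (v := a₂) [a, a₁, w]
        (by
          simp only [List.mem_cons, List.not_mem_nil]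
          grind [SimpleGraph.Adj.symm, SimpleGraph.Adj.ne])
      have := card_nbrs_toFinset_le (G := G) (l := [a, y, a₁, b, a₂, w]) (v := w) [a₁, b, a₂]
        (by
          simp only [List.mem_cons, List.not_mem_nil]
          grind [SimpleGraph.Adj.symm, SimpleGraph.Adj.ne])
      simp only [List.length_cons, List.length_nil] at *
      omega
  have := unit_two y2
  have := unit_three y10
  have := unit_three w2
  simp only [List.cons_append, List.nil_append, List.map_cons, List.map_nil, List.sum_cons,
    List.sum_nil, List.length_cons, List.length_nil] at *
  omega

/-- A neighbour of `a` is adjacent to some neighbour of `b`. -/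
lemma bridge_exists_adj (h : Irreducible G A X) (hB : Bridge G A y a b a₁ a₂ b₁ b₂)
    (hu : ¬ (G.Adj a₂ b₁ ∧ G.Adj a₂ b₂)) (h1 : ¬ G.Adj a₁ b₁) (h2 : ¬ G.Adj a₁ b₂) : False := by
  obtain ⟨hab, ⟨n1, n2, n3, n4⟩, d1, d2, d3, d4⟩ := h.bridge_facts hB
  have m1 := h.bridge_not_adj hB
  have m2 := h.bridge_not_adj hB.swap
  obtain ⟨⟨y1, y2, y3, y4, y5, y6, y7, y8⟩, ⟨-, y10, -, a1, a2, -, a3, a4, a5, a6, a7, a8⟩,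
    ⟨-, y11, -, b1, b2, -, b3, b4, b5, b6, b7, b8⟩⟩ := hB
  have hsub : ∀ t ∈ [y, a, b, a₁, a₂, b₁, b₂], t ∈ A := by simp [*]
  -- Keep the path `a y b` (16). The four discarded vertices pay 8 plus their inner degrees, which
  -- sum to at most 6 because at most one edge joins them.
  refine h.absurd_of_lists [y] [a, b] [a₁, a₂, b₁, b₂] hsub ?_ (by
      simp only [List.cons_append, List.nil_append, List.nodup_cons, List.mem_cons,
        List.not_mem_nil, List.nodup_nil]; grind [SimpleGraph.Adj.symm, SimpleGraph.Adj.ne]) (by simp)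
    (by simp) ?_ (by simp) ?_
  · simp only [List.cons_append, List.nil_append, List.mem_cons, List.not_mem_nil]
    grind [SimpleGraph.Adj.symm, SimpleGraph.Adj.ne]
  · simp only [List.mem_cons, List.not_mem_nil]; grind [SimpleGraph.Adj.symm, SimpleGraph.Adj.ne]
  have e1 := card_nbrs_toFinset_le (G := G) (l := [y, a, b, a₁, a₂, b₁, b₂]) (v := a₁) [a] (by
          simp only [List.mem_cons, List.not_mem_nil]
          grind [SimpleGraph.Adj.symm, SimpleGraph.Adj.ne])
  have e2 : (nbrs G [y, a, b, a₁, a₂, b₁, b₂].toFinset a₂).card +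
      (nbrs G [y, a, b, a₁, a₂, b₁, b₂].toFinset b₁).card +
      (nbrs G [y, a, b, a₁, a₂, b₁, b₂].toFinset b₂).card ≤ 5 := by
    by_cases k : G.Adj a₂ b₁
    · have := card_nbrs_toFinset_le (G := G) (l := [y, a, b, a₁, a₂, b₁, b₂]) (v := a₂) [a, b₁]
        (by
          simp only [List.mem_cons, List.not_mem_nil]
          grind [SimpleGraph.Adj.symm, SimpleGraph.Adj.ne])
      have := card_nbrs_toFinset_le (G := G) (l := [y, a, b, a₁, a₂, b₁, b₂]) (v := b₁) [b, a₂]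
        (by
          simp only [List.mem_cons, List.not_mem_nil]
          grind [SimpleGraph.Adj.symm, SimpleGraph.Adj.ne])
      have := card_nbrs_toFinset_le (G := G) (l := [y, a, b, a₁, a₂, b₁, b₂]) (v := b₂) [b]
        (by
          simp only [List.mem_cons, List.not_mem_nil]
          grind [SimpleGraph.Adj.symm, SimpleGraph.Adj.ne])
      simp only [List.length_cons, List.length_nil] at *
      omega
    · have := card_nbrs_toFinset_le (G := G) (l := [y, a, b, a₁, a₂, b₁, b₂]) (v := a₂) [a, b₂]
        (by
          simp only [List.mem_cons, List.not_mem_nil]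
          grind [SimpleGraph.Adj.symm, SimpleGraph.Adj.ne])
      have := card_nbrs_toFinset_le (G := G) (l := [y, a, b, a₁, a₂, b₁, b₂]) (v := b₁) [b]
        (by
          simp only [List.mem_cons, List.not_mem_nil]
          grind [SimpleGraph.Adj.symm, SimpleGraph.Adj.ne])
      have := card_nbrs_toFinset_le (G := G) (l := [y, a, b, a₁, a₂, b₁, b₂]) (v := b₂) [b, a₂]
        (by
          simp only [List.mem_cons, List.not_mem_nil]
          grind [SimpleGraph.Adj.symm, SimpleGraph.Adj.ne])
      simp only [List.length_cons, List.length_nil] at *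
      omega
  have := unit_two y2
  have := unit_three y10
  have := unit_three y11
  have := unit_three d1
  have := unit_three d2
  have := unit_three d3
  have := unit_three d4
  simp only [List.cons_append, List.nil_append, List.map_cons, List.map_nil, List.sum_cons,
    List.sum_nil, List.length_cons, List.length_nil] at *
  omega

/-- If `a₁` is adjacent to `b₁` and `b₂` then `a₂` is not adjacent to `b₁`. -/
lemma bridge_path (h : Irreducible G A X) (hB : Bridge G A y a b a₁ a₂ b₁ b₂)
    (h1 : G.Adj a₁ b₁) (h2 : G.Adj a₁ b₂) (h3 : G.Adj a₂ b₁) : False := by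
  obtain ⟨hab, ⟨n1, n2, n3, n4⟩, d1, d2, d3, d4⟩ := h.bridge_facts hB
  have m1 := h.bridge_not_adj hB
  have m2 := h.bridge_not_adj hB.swap
  obtain ⟨⟨y1, y2, y3, y4, y5, y6, y7, y8⟩, ⟨-, y10, -, a1, a2, -, a3, a4, a5, a6, a7, a8⟩,
    ⟨-, y11, -, b1, b2, -, b3, b4, b5, b6, b7, b8⟩⟩ := hB
  obtain ⟨u, hu⟩ := exists_nbrs3 a1 d1 y3 a3.symm b1 h1 (by rintro rfl; exact hab b3.symm)
  obtain ⟨v, hv⟩ := exists_nbrs3 b1 d3 y4 b3.symm a1 h1.symm (by rintro rfl; exact hab a3)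
  obtain ⟨z, hz⟩ := exists_nbrs3 b2 d4 y4 b4.symm a1 h2.symm (by rintro rfl; exact hab a3)
  have k1 := hu.only
  have k2 := hv.only
  have hzd := h.card_eq hz.memz
  obtain ⟨-, -, -, -, z1, -, -, z2, -, z3, z4, z5⟩ := hz
  clear hu hv
  have := unit_two y2
  have := unit_three y10
  have := unit_three y11
  have := unit_three d1
  have := unit_three d2
  have := unit_three d3
  have := unit_three d4
  -- The default choice is the star at `b` with leaves `y`, `b₁`, `b₂`: it pays 21, leaving 19 for
  -- the discarded vertices. Here `z` is the third neighbour of `b₂`.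
  by_cases hza : z = a₂
  · have hsub : ∀ t ∈ [b, y, b₁, b₂, a, a₁, a₂], t ∈ A := by simp [*]
    refine h.absurd_of_lists [b] [y, b₁, b₂] [a, a₁, a₂] hsub ?_ (by
      simp only [List.cons_append, List.nil_append, List.nodup_cons, List.mem_cons,
        List.not_mem_nil, List.nodup_nil]; grind [SimpleGraph.Adj.symm, SimpleGraph.Adj.ne]) (by simp)
      (by simp) ?_ (by simp) ?_
    · simp only [List.cons_append, List.nil_append, List.mem_cons, List.not_mem_nil]
      grind [SimpleGraph.Adj.symm, SimpleGraph.Adj.ne]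
    · simp only [List.mem_cons, List.not_mem_nil]; grind [SimpleGraph.Adj.symm, SimpleGraph.Adj.ne]
    have := h.unit_add_le hsub y3
    have := h.unit_add_le hsub a1
    have := h.unit_add_le hsub a2
    simp only [List.cons_append, List.nil_append, List.map_cons, List.map_nil, List.sum_cons,
      List.sum_nil, List.length_cons, List.length_nil] at *
    omega
  -- In this exceptional case the star at `b` would be too expensive. Instead keep the edges `ya`,
  -- `z b₂` and the isolated vertex `b₁`, paying at most 27+18 = 45 for 50.
  by_cases hsp : G.Adj z a₂ ∧ (nbrs G A z).card = 2
  · obtain ⟨hza₂, hzd⟩ := hsp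
    obtain ⟨z', hz'⟩ := exists_nbrs2 z1 hzd b2 z2.symm
    have hz'o := hz'.only
    clear hz'
    have := unit_two hzd
    have hsub : ∀ t ∈ [y, z, b₁, a, b₂, a₁, b, a₂], t ∈ A := by simp [*]
    refine h.absurd_of_lists [y, z, b₁] [a, b₂] [a₁, b, a₂] hsub ?_ (by
      simp only [List.cons_append, List.nil_append, List.nodup_cons, List.mem_cons,
        List.not_mem_nil, List.nodup_nil]; grind [SimpleGraph.Adj.symm, SimpleGraph.Adj.ne]) (by simp) ?_ ?_ ?_ ?_
    · simp only [List.cons_append, List.nil_append, List.mem_cons, List.not_mem_nil]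
      grind [SimpleGraph.Adj.symm, SimpleGraph.Adj.ne]
    · simp only [List.mem_cons, List.not_mem_nil]; grind [SimpleGraph.Adj.symm, SimpleGraph.Adj.ne]
    · simp only [List.mem_cons, List.not_mem_nil]; grind [SimpleGraph.Adj.symm, SimpleGraph.Adj.ne]
    · simp only [List.mem_cons, List.not_mem_nil]; grind [SimpleGraph.Adj.symm, SimpleGraph.Adj.ne]
    have := h.unit_add_le hsub y4
    have := h.unit_add_le hsub a1
    have := h.unit_add_le hsub a2
    simp only [List.cons_append, List.nil_append, List.map_cons, List.map_nil, List.sum_cons,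
      List.sum_nil, List.length_cons, List.length_nil] at *
    omega
  · have hsub : ∀ t ∈ [b, y, b₁, b₂, a, a₁, a₂, z], t ∈ A := by simp [*]
    refine h.absurd_of_lists [b] [y, b₁, b₂] [a, a₁, a₂, z] hsub ?_ (by
      simp only [List.cons_append, List.nil_append, List.nodup_cons, List.mem_cons,
        List.not_mem_nil, List.nodup_nil]; grind [SimpleGraph.Adj.symm, SimpleGraph.Adj.ne]) (by simp)
      (by simp) ?_ (by simp) ?_
    · simp only [List.cons_append, List.nil_append, List.mem_cons, List.not_mem_nil]
      grind [SimpleGraph.Adj.symm, SimpleGraph.Adj.ne]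
    · simp only [List.mem_cons, List.not_mem_nil]; grind [SimpleGraph.Adj.symm, SimpleGraph.Adj.ne]
    have := card_nbrs_toFinset_le (G := G) (l := [b, y, b₁, b₂, a, a₁, a₂, z]) (v := a)
      [y, a₁, a₂] (by
          simp only [List.mem_cons, List.not_mem_nil]
          grind [SimpleGraph.Adj.symm, SimpleGraph.Adj.ne])
    have := card_nbrs_toFinset_le (G := G) (l := [b, y, b₁, b₂, a, a₁, a₂, z]) (v := a₁)
      [a, b₁, b₂] (by
          simp only [List.mem_cons, List.not_mem_nil]
          grind [SimpleGraph.Adj.symm, SimpleGraph.Adj.ne])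
    have e : unit G A z + (nbrs G [b, y, b₁, b₂, a, a₁, a₂, z].toFinset z).card +
        (nbrs G [b, y, b₁, b₂, a, a₁, a₂, z].toFinset a₂).card ≤ 7 := by
      by_cases hza₂ : G.Adj z a₂
      · have hzd' := unit_three (hzd.resolve_left fun h => hsp ⟨hza₂, h⟩)
        have := card_nbrs_toFinset_le (G := G) (l := [b, y, b₁, b₂, a, a₁, a₂, z]) (v := z)
          [b₂, a₂] (by
          simp only [List.mem_cons, List.not_mem_nil]
          grind [SimpleGraph.Adj.symm, SimpleGraph.Adj.ne])
        have := card_nbrs_toFinset_le (G := G) (l := [b, y, b₁, b₂, a, a₁, a₂, z]) (v := a₂)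
          [a, b₁, z] (by
          simp only [List.mem_cons, List.not_mem_nil]
          grind [SimpleGraph.Adj.symm, SimpleGraph.Adj.ne])
        simp only [List.length_cons, List.length_nil] at *
        omega
      · have hzd' : unit G A z ≤ 4 := by unfold unit; split_ifs <;> omega
        have := card_nbrs_toFinset_le (G := G) (l := [b, y, b₁, b₂, a, a₁, a₂, z]) (v := z) [b₂] (by
          simp only [List.mem_cons, List.not_mem_nil]
          grind [SimpleGraph.Adj.symm, SimpleGraph.Adj.ne])
        have := card_nbrs_toFinset_le (G := G) (l := [b, y, b₁, b₂, a, a₁, a₂, z]) (v := a₂)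
          [a, b₁] (by
          simp only [List.mem_cons, List.not_mem_nil]
          grind [SimpleGraph.Adj.symm, SimpleGraph.Adj.ne])
        simp only [List.length_cons, List.length_nil] at *
        omega
    simp only [List.cons_append, List.nil_append, List.map_cons, List.map_nil, List.sum_cons,
      List.sum_nil, List.length_cons, List.length_nil] at *
    omega

/-- A neighbour of `a` is adjacent to at most one neighbour of `b`. -/
lemma bridge_not_both (h : Irreducible G A X) (hB : Bridge G A y a b a₁ a₂ b₁ b₂)
    (h1 : G.Adj a₁ b₁) (h2 : G.Adj a₁ b₂) : False := by
  obtain ⟨hab, ⟨n1, n2, n3, n4⟩, d1, d2, d3, d4⟩ := h.bridge_facts hB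
  have m1 := h.bridge_not_adj hB
  have m2 := h.bridge_not_adj hB.swap
  have m3 := h.bridge_path hB h1 h2
  have m4 := h.bridge_path hB.swapb h2 h1
  obtain ⟨⟨y1, y2, y3, y4, y5, y6, y7, y8⟩, ⟨-, y10, -, a1, a2, -, a3, a4, a5, a6, a7, a8⟩,
    ⟨-, y11, -, b1, b2, -, b3, b4, b5, b6, b7, b8⟩⟩ := hB
  obtain ⟨u, hu⟩ := exists_nbrs3 a1 d1 y3 a3.symm b1 h1 (by rintro rfl; exact hab b3.symm)
  obtain ⟨z, hz⟩ := exists_nbrs3 b1 d3 y4 b3.symm a1 h1.symm (by rintro rfl; exact hab a3)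
  obtain ⟨w, hw⟩ := exists_nbrs3 b2 d4 y4 b4.symm a1 h2.symm (by rintro rfl; exact hab a3)
  have k1 := hu.only
  have hzd := h.card_eq hz.memz
  have hwd := h.card_eq hw.memz
  obtain ⟨-, -, -, -, z1, -, -, z2, -, z3, z4, z5⟩ := hz
  obtain ⟨-, -, -, -, w1, -, -, w2, -, w3, w4, w5⟩ := hw
  clear hu
  have := unit_two y2
  have := unit_three y10
  have := unit_three y11
  have := unit_three d1
  have := unit_three d3
  have := unit_three d4
  -- Again the star at `b`, with 19 left; `z` and `w` are the third neighbours of `b₁` and `b₂`.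
  by_cases hzw : z = w
  · have hsub : ∀ t ∈ [b, y, b₁, b₂, a, a₁, z], t ∈ A := by simp [*]
    refine h.absurd_of_lists [b] [y, b₁, b₂] [a, a₁, z] hsub ?_ (by
      simp only [List.cons_append, List.nil_append, List.nodup_cons, List.mem_cons,
        List.not_mem_nil, List.nodup_nil]; grind [SimpleGraph.Adj.symm, SimpleGraph.Adj.ne]) (by simp)
      (by simp) ?_ (by simp) ?_
    · simp only [List.cons_append, List.nil_append, List.mem_cons, List.not_mem_nil]
      grind [SimpleGraph.Adj.symm, SimpleGraph.Adj.ne]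
    · simp only [List.mem_cons, List.not_mem_nil]; grind [SimpleGraph.Adj.symm, SimpleGraph.Adj.ne]
    have := h.unit_add_le hsub y3
    have := h.unit_add_le hsub a1
    have := h.unit_add_le hsub z1
    simp only [List.cons_append, List.nil_append, List.map_cons, List.map_nil, List.sum_cons,
      List.sum_nil, List.length_cons, List.length_nil] at *
    omega
  · have hsub : ∀ t ∈ [b, y, b₁, b₂, a, a₁, z, w], t ∈ A := by simp [*]
    refine h.absurd_of_lists [b] [y, b₁, b₂] [a, a₁, z, w] hsub ?_ (by
      simp only [List.cons_append, List.nil_append, List.nodup_cons, List.mem_cons,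
        List.not_mem_nil, List.nodup_nil]; grind [SimpleGraph.Adj.symm, SimpleGraph.Adj.ne]) (by simp)
      (by simp) ?_ (by simp) ?_
    · simp only [List.cons_append, List.nil_append, List.mem_cons, List.not_mem_nil]
      grind [SimpleGraph.Adj.symm, SimpleGraph.Adj.ne]
    · simp only [List.mem_cons, List.not_mem_nil]; grind [SimpleGraph.Adj.symm, SimpleGraph.Adj.ne]
    have := card_nbrs_toFinset_le (G := G) (l := [b, y, b₁, b₂, a, a₁, z, w]) (v := a) [y, a₁] (by
          simp only [List.mem_cons, List.not_mem_nil]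
          grind [SimpleGraph.Adj.symm, SimpleGraph.Adj.ne])
    have := card_nbrs_toFinset_le (G := G) (l := [b, y, b₁, b₂, a, a₁, z, w]) (v := a₁)
      [a, b₁, b₂] (by
          simp only [List.mem_cons, List.not_mem_nil]
          grind [SimpleGraph.Adj.symm, SimpleGraph.Adj.ne])
    have e : unit G A z + (nbrs G [b, y, b₁, b₂, a, a₁, z, w].toFinset z).card +
        unit G A w + (nbrs G [b, y, b₁, b₂, a, a₁, z, w].toFinset w).card ≤ 10 := by
      by_cases hadj : G.Adj z w
      · have := card_nbrs_toFinset_le (G := G) (l := [b, y, b₁, b₂, a, a₁, z, w]) (v := z) [b₁, w] (by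
          simp only [List.mem_cons, List.not_mem_nil]
          grind [SimpleGraph.Adj.symm, SimpleGraph.Adj.ne])
        have := card_nbrs_toFinset_le (G := G) (l := [b, y, b₁, b₂, a, a₁, z, w]) (v := w)
          [b₂, z] (by
          simp only [List.mem_cons, List.not_mem_nil]
          grind [SimpleGraph.Adj.symm, SimpleGraph.Adj.ne])
        -- Adjacent vertices cannot both have degree two, by `card_nbr`.
        have hd : unit G A z + unit G A w ≤ 6 := by
          rcases hzd with hzd | hzd
          · obtain ⟨v, hv⟩ := exists_nbrs2 z1 hzd w1 hadj
            rw [unit_two hzd, unit_three (h.card_nbr hv)]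
          · rw [unit_three hzd]
            unfold unit; split_ifs <;> omega
        simp only [List.length_cons, List.length_nil] at *
        omega
      · have := card_nbrs_toFinset_le (G := G) (l := [b, y, b₁, b₂, a, a₁, z, w]) (v := z) [b₁] (by
          simp only [List.mem_cons, List.not_mem_nil]
          grind [SimpleGraph.Adj.symm, SimpleGraph.Adj.ne])
        have := card_nbrs_toFinset_le (G := G) (l := [b, y, b₁, b₂, a, a₁, z, w]) (v := w) [b₂] (by
          simp only [List.mem_cons, List.not_mem_nil]
          grind [SimpleGraph.Adj.symm, SimpleGraph.Adj.ne])
        have hzd' : unit G A z ≤ 4 := by unfold unit; split_ifs <;> omega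
        have hwd' : unit G A w ≤ 4 := by unfold unit; split_ifs <;> omega
        simp only [List.length_cons, List.length_nil] at *
        omega
    simp only [List.cons_append, List.nil_append, List.map_cons, List.map_nil, List.sum_cons,
      List.sum_nil, List.length_cons, List.length_nil] at *
    omega

/-- The neighbours of `a` and `b` do not form a matching. -/
lemma bridge_not_matching (h : Irreducible G A X) (hB : Bridge G A y a b a₁ a₂ b₁ b₂)
    (h1 : G.Adj a₁ b₁) (h2 : G.Adj a₂ b₂) (h3 : ¬ G.Adj a₁ b₂) (h4 : ¬ G.Adj a₂ b₁) :
    False := by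
  obtain ⟨hab, ⟨n1, n2, n3, n4⟩, d1, d2, d3, d4⟩ := h.bridge_facts hB
  have m1 := h.bridge_not_adj hB
  have m2 := h.bridge_not_adj hB.swap
  obtain ⟨⟨y1, y2, y3, y4, y5, y6, y7, y8⟩, ⟨-, y10, -, a1, a2, -, a3, a4, a5, a6, a7, a8⟩,
    ⟨-, y11, -, b1, b2, -, b3, b4, b5, b6, b7, b8⟩⟩ := hB
  obtain ⟨w, hw⟩ := exists_nbrs3 a1 d1 y3 a3.symm b1 h1 (by rintro rfl; exact hab b3.symm)
  have hwd := h.card_eq hw.memz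
  obtain ⟨-, -, -, -, w1, -, -, w2, -, w3, w4, w5⟩ := hw
  have u1 := unit_two y2
  have u2 := unit_three y10
  have u3 := unit_three y11
  have u4 := unit_three d1
  have u5 := unit_three d2
  have u6 := unit_three d3
  have u7 := unit_three d4
  -- If the third neighbour `w` of `a₁` is also adjacent to `a₂`, keep the star at `a` with leaves
  -- `y`, `a₁`, `a₂`: 21, plus at most 19 for the rest.
  by_cases hwa : G.Adj w a₂
  · obtain ⟨v, hv⟩ := exists_nbrs3 a2 d2 y3 a4.symm b2 h2 (by rintro rfl; exact hab b4.symm)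
    have k1 := hv.only
    clear hv
    have hsub : ∀ t ∈ [a, y, a₁, a₂, b, b₁, b₂, w], t ∈ A := by simp [*]
    refine h.absurd_of_lists [a] [y, a₁, a₂] [b, b₁, b₂, w] hsub ?_ (by
      simp only [List.cons_append, List.nil_append, List.nodup_cons, List.mem_cons,
        List.not_mem_nil, List.nodup_nil]; grind [SimpleGraph.Adj.symm, SimpleGraph.Adj.ne]) (by simp)
      (by simp) ?_ (by simp) ?_
    · simp only [List.cons_append, List.nil_append, List.mem_cons, List.not_mem_nil]
      grind [SimpleGraph.Adj.symm, SimpleGraph.Adj.ne]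
    · simp only [List.mem_cons, List.not_mem_nil]; grind [SimpleGraph.Adj.symm, SimpleGraph.Adj.ne]
    have := card_nbrs_toFinset_le (G := G) (l := [a, y, a₁, a₂, b, b₁, b₂, w]) (v := b)
      [y, b₁, b₂] (by
          simp only [List.mem_cons, List.not_mem_nil]
          grind [SimpleGraph.Adj.symm, SimpleGraph.Adj.ne])
    have e : unit G A w + (nbrs G [a, y, a₁, a₂, b, b₁, b₂, w].toFinset w).card +
        (nbrs G [a, y, a₁, a₂, b, b₁, b₂, w].toFinset b₁).card +
        (nbrs G [a, y, a₁, a₂, b, b₁, b₂, w].toFinset b₂).card ≤ 10 := by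
      rcases hwd with hwd | hwd
      · obtain ⟨v', hv'⟩ := exists_nbrs2 w1 hwd a1 w2.symm
        have k2 := hv'.only
        clear hv'
        rw [unit_two hwd]
        have := card_nbrs_toFinset_le (G := G) (l := [a, y, a₁, a₂, b, b₁, b₂, w]) (v := w)
          [a₁, a₂] (by
          simp only [List.mem_cons, List.not_mem_nil]
          grind [SimpleGraph.Adj.symm, SimpleGraph.Adj.ne])
        have := card_nbrs_toFinset_le (G := G) (l := [a, y, a₁, a₂, b, b₁, b₂, w]) (v := b₁)
          [b, a₁] (by
          simp only [List.mem_cons, List.not_mem_nil]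
          grind [SimpleGraph.Adj.symm, SimpleGraph.Adj.ne])
        have := card_nbrs_toFinset_le (G := G) (l := [a, y, a₁, a₂, b, b₁, b₂, w]) (v := b₂)
          [b, a₂] (by
          simp only [List.mem_cons, List.not_mem_nil]
          grind [SimpleGraph.Adj.symm, SimpleGraph.Adj.ne])
        simp only [List.length_cons, List.length_nil] at *
        omega
      · obtain ⟨v', hv'⟩ := exists_nbrs3 w1 hwd a1 w2.symm a2 hwa (by rintro rfl; exact h4 h1)
        have k2 := hv'.only
        clear hv'
        rw [unit_three hwd]
        have := card_nbrs_toFinset_le (G := G) (l := [a, y, a₁, a₂, b, b₁, b₂, w]) (v := w)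
          [a₁, a₂, v'] (by
          simp only [List.mem_cons, List.not_mem_nil]
          grind [SimpleGraph.Adj.symm, SimpleGraph.Adj.ne])
        by_cases hwb : G.Adj w b₁
        · have := card_nbrs_toFinset_le (G := G) (l := [a, y, a₁, a₂, b, b₁, b₂, w]) (v := b₁) [b, a₁, w] (by
          simp only [List.mem_cons, List.not_mem_nil]
          grind [SimpleGraph.Adj.symm, SimpleGraph.Adj.ne])
          have := card_nbrs_toFinset_le (G := G) (l := [a, y, a₁, a₂, b, b₁, b₂, w]) (v := b₂)
            [b, a₂] (by
          simp only [List.mem_cons, List.not_mem_nil]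
          grind [SimpleGraph.Adj.symm, SimpleGraph.Adj.ne])
          simp only [List.length_cons, List.length_nil] at *
          omega
        · have := card_nbrs_toFinset_le (G := G) (l := [a, y, a₁, a₂, b, b₁, b₂, w]) (v := b₁) [b, a₁] (by
          simp only [List.mem_cons, List.not_mem_nil]
          grind [SimpleGraph.Adj.symm, SimpleGraph.Adj.ne])
          have := card_nbrs_toFinset_le (G := G) (l := [a, y, a₁, a₂, b, b₁, b₂, w]) (v := b₂)
            [b, a₂, w] (by
          simp only [List.mem_cons, List.not_mem_nil]
          grind [SimpleGraph.Adj.symm, SimpleGraph.Adj.ne])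
          simp only [List.length_cons, List.length_nil] at *
          omega
    simp only [List.cons_append, List.nil_append, List.map_cons, List.map_nil, List.sum_cons,
      List.sum_nil, List.length_cons, List.length_nil] at *
    omega
  -- In the triangle `a₁ b₁ w`, keep the edge `a₁ b₁` together with `y` as an isolated vertex:
  -- 16+4+4+6 = 30.
  by_cases hwb : G.Adj w b₁
  · obtain ⟨v, hv⟩ := exists_nbrs3 b1 d3 y4 b3.symm a1 h1.symm (by rintro rfl; exact hab a3)
    have k1 := hv.only
    clear hv
    have hsub : ∀ t ∈ [a₁, y, b₁, a, b, w], t ∈ A := by simp [*]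
    refine h.absurd_of_lists [a₁, y] [b₁] [a, b, w] hsub ?_ (by
      simp only [List.cons_append, List.nil_append, List.nodup_cons, List.mem_cons,
        List.not_mem_nil, List.nodup_nil]; grind [SimpleGraph.Adj.symm, SimpleGraph.Adj.ne]) (by simp) ?_ (by simp) ?_ ?_
    · simp only [List.cons_append, List.nil_append, List.mem_cons, List.not_mem_nil]
      grind [SimpleGraph.Adj.symm, SimpleGraph.Adj.ne]
    · simp only [List.mem_cons, List.not_mem_nil]; grind [SimpleGraph.Adj.symm, SimpleGraph.Adj.ne]
    · simp only [List.mem_cons, List.not_mem_nil]; grind [SimpleGraph.Adj.symm, SimpleGraph.Adj.ne]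
    have := card_nbrs_toFinset_le (G := G) (l := [a₁, y, b₁, a, b, w]) (v := a) [y, a₁] (by
          simp only [List.mem_cons, List.not_mem_nil]
          grind [SimpleGraph.Adj.symm, SimpleGraph.Adj.ne])
    have := card_nbrs_toFinset_le (G := G) (l := [a₁, y, b₁, a, b, w]) (v := b) [y, b₁] (by
          simp only [List.mem_cons, List.not_mem_nil]
          grind [SimpleGraph.Adj.symm, SimpleGraph.Adj.ne])
    have := h.unit_add_le hsub w1
    simp only [List.cons_append, List.nil_append, List.map_cons, List.map_nil, List.sum_cons,
      List.sum_nil, List.length_cons, List.length_nil] at *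
    omega
  rcases hwd with hwd | hwd
  · obtain ⟨c, hc⟩ := exists_nbrs2 w1 hwd a1 w2.symm
    have hc3 := h.card_nbr hc.swap
    have u8 := unit_two hwd
    obtain ⟨-, -, -, c1, -, c2, c3, c4⟩ := hc
    -- If the second neighbour `c` of `w` is `b₂`, keep the star at `a` with leaves `y`, `a₁` and
    -- the isolated vertex `b₂`. Otherwise keep the star at `a₁` with leaves `w`, `b₁`.
    by_cases hcb : c = b₂
    · obtain ⟨v, hv⟩ := exists_nbrs3 b2 d4 y4 b4.symm a2 h2.symm (by rintro rfl; exact hab a4)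
      have k1 := hv.only
      clear hv
      have hsub : ∀ t ∈ [a, b₂, y, a₁, a₂, b, b₁, w], t ∈ A := by simp [*]
      refine h.absurd_of_lists [a, b₂] [y, a₁] [a₂, b, b₁, w] hsub ?_ (by
      simp only [List.cons_append, List.nil_append, List.nodup_cons, List.mem_cons,
        List.not_mem_nil, List.nodup_nil]; grind [SimpleGraph.Adj.symm, SimpleGraph.Adj.ne]) (by simp) ?_ ?_ ?_ ?_
      · simp only [List.cons_append, List.nil_append, List.mem_cons, List.not_mem_nil]
        grind [SimpleGraph.Adj.symm, SimpleGraph.Adj.ne]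
      · simp only [List.mem_cons, List.not_mem_nil]
        grind [SimpleGraph.Adj.symm, SimpleGraph.Adj.ne]
      · simp only [List.mem_cons, List.not_mem_nil]
        grind [SimpleGraph.Adj.symm, SimpleGraph.Adj.ne]
      · simp only [List.mem_cons, List.not_mem_nil]
        grind [SimpleGraph.Adj.symm, SimpleGraph.Adj.ne]
      have := card_nbrs_toFinset_le (G := G) (l := [a, b₂, y, a₁, a₂, b, b₁, w]) (v := a₂)
        [a, b₂] (by
          simp only [List.mem_cons, List.not_mem_nil]
          grind [SimpleGraph.Adj.symm, SimpleGraph.Adj.ne])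
      have := card_nbrs_toFinset_le (G := G) (l := [a, b₂, y, a₁, a₂, b, b₁, w]) (v := b)
        [y, b₁, b₂] (by
          simp only [List.mem_cons, List.not_mem_nil]
          grind [SimpleGraph.Adj.symm, SimpleGraph.Adj.ne])
      have := card_nbrs_toFinset_le (G := G) (l := [a, b₂, y, a₁, a₂, b, b₁, w]) (v := b₁)
        [b, a₁] (by
          simp only [List.mem_cons, List.not_mem_nil]
          grind [SimpleGraph.Adj.symm, SimpleGraph.Adj.ne])
      have := h.unit_add_le hsub w1
      simp only [List.cons_append, List.nil_append, List.map_cons, List.map_nil, List.sum_cons,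
        List.sum_nil, List.length_cons, List.length_nil] at *
      omega
    · obtain ⟨z, hz⟩ := exists_nbrs3 b1 d3 y4 b3.symm a1 h1.symm (by rintro rfl; exact hab a3)
      have hzd := h.card_eq hz.memz
      obtain ⟨-, -, -, -, z1, -, -, z2, -, z3, z4, z5⟩ := hz
      have u9 := unit_three hc3
      have hsub : ∀ t ∈ [a₁, w, b₁, c, a, b, z], t ∈ A := by simp [*]
      refine h.absurd_of_lists [a₁] [w, b₁] [c, a, b, z] hsub ?_ (by
      simp only [List.cons_append, List.nil_append, List.nodup_cons, List.mem_cons,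
        List.not_mem_nil, List.nodup_nil]; grind [SimpleGraph.Adj.symm, SimpleGraph.Adj.ne]) (by simp)
        (by simp) ?_ (by simp) ?_
      · simp only [List.cons_append, List.nil_append, List.mem_cons, List.not_mem_nil]
        grind [SimpleGraph.Adj.symm, SimpleGraph.Adj.ne]
      · simp only [List.mem_cons, List.not_mem_nil]
        grind [SimpleGraph.Adj.symm, SimpleGraph.Adj.ne]
      have := card_nbrs_toFinset_le (G := G) (l := [a₁, w, b₁, c, a, b, z]) (v := a) [a₁] (by
          simp only [List.mem_cons, List.not_mem_nil]
          grind [SimpleGraph.Adj.symm, SimpleGraph.Adj.ne])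
      have := card_nbrs_toFinset_le (G := G) (l := [a₁, w, b₁, c, a, b, z]) (v := b) [b₁] (by
          simp only [List.mem_cons, List.not_mem_nil]
          grind [SimpleGraph.Adj.symm, SimpleGraph.Adj.ne])
      have e : (nbrs G [a₁, w, b₁, c, a, b, z].toFinset c).card + unit G A z +
          (nbrs G [a₁, w, b₁, c, a, b, z].toFinset z).card ≤ 6 := by
        by_cases hcz : c = z
        · have hz3 : unit G A z = 2 := hcz ▸ u9
          have := card_nbrs_toFinset_le (G := G) (l := [a₁, w, b₁, c, a, b, z]) (v := c) [w, b₁] (by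
          simp only [List.mem_cons, List.not_mem_nil]
          grind [SimpleGraph.Adj.symm, SimpleGraph.Adj.ne])
          have := card_nbrs_toFinset_le (G := G) (l := [a₁, w, b₁, c, a, b, z]) (v := z) [w, b₁] (by
          simp only [List.mem_cons, List.not_mem_nil]
          grind [SimpleGraph.Adj.symm, SimpleGraph.Adj.ne])
          simp only [List.length_cons, List.length_nil] at *
          omega
        by_cases hcz' : G.Adj c z
        · have hz3 := unit_three (h.card_eq_three c1 hc3 w1 z1 (by rintro rfl; exact hwb z2.symm)
            c2.symm hcz' hwd)
          have := card_nbrs_toFinset_le (G := G) (l := [a₁, w, b₁, c, a, b, z]) (v := c) [w, z] (by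
          simp only [List.mem_cons, List.not_mem_nil]
          grind [SimpleGraph.Adj.symm, SimpleGraph.Adj.ne])
          have := card_nbrs_toFinset_le (G := G) (l := [a₁, w, b₁, c, a, b, z]) (v := z) [b₁, c] (by
          simp only [List.mem_cons, List.not_mem_nil]
          grind [SimpleGraph.Adj.symm, SimpleGraph.Adj.ne])
          simp only [List.length_cons, List.length_nil] at *
          omega
        · have hz3 : unit G A z ≤ 4 := by unfold unit; split_ifs <;> omega
          have := card_nbrs_toFinset_le (G := G) (l := [a₁, w, b₁, c, a, b, z]) (v := c) [w] (by
          simp only [List.mem_cons, List.not_mem_nil]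
          grind [SimpleGraph.Adj.symm, SimpleGraph.Adj.ne])
          have := card_nbrs_toFinset_le (G := G) (l := [a₁, w, b₁, c, a, b, z]) (v := z) [b₁] (by
          simp only [List.mem_cons, List.not_mem_nil]
          grind [SimpleGraph.Adj.symm, SimpleGraph.Adj.ne])
          simp only [List.length_cons, List.length_nil] at *
          omega
      simp only [List.cons_append, List.nil_append, List.map_cons, List.map_nil, List.sum_cons,
        List.sum_nil, List.length_cons, List.length_nil] at *
      omega
  -- With `w` of degree three, the star at `a` with leaves `y`, `a₁` suffices: 16+4+3+4+3 = 30.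
  · have u8 := unit_three hwd
    have hsub : ∀ t ∈ [a, y, a₁, b, a₂, b₁, w], t ∈ A := by simp [*]
    refine h.absurd_of_lists [a] [y, a₁] [b, a₂, b₁, w] hsub ?_ (by
      simp only [List.cons_append, List.nil_append, List.nodup_cons, List.mem_cons,
        List.not_mem_nil, List.nodup_nil]; grind [SimpleGraph.Adj.symm, SimpleGraph.Adj.ne]) (by simp)
      (by simp) ?_ (by simp) ?_
    · simp only [List.cons_append, List.nil_append, List.mem_cons, List.not_mem_nil]
      grind [SimpleGraph.Adj.symm, SimpleGraph.Adj.ne]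
    · simp only [List.mem_cons, List.not_mem_nil]; grind [SimpleGraph.Adj.symm, SimpleGraph.Adj.ne]
    have := card_nbrs_toFinset_le (G := G) (l := [a, y, a₁, b, a₂, b₁, w]) (v := b) [y, b₁] (by
          simp only [List.mem_cons, List.not_mem_nil]
          grind [SimpleGraph.Adj.symm, SimpleGraph.Adj.ne])
    have := card_nbrs_toFinset_le (G := G) (l := [a, y, a₁, b, a₂, b₁, w]) (v := a₂) [a] (by
          simp only [List.mem_cons, List.not_mem_nil]
          grind [SimpleGraph.Adj.symm, SimpleGraph.Adj.ne])
    have := card_nbrs_toFinset_le (G := G) (l := [a, y, a₁, b, a₂, b₁, w]) (v := b₁) [b, a₁] (by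
          simp only [List.mem_cons, List.not_mem_nil]
          grind [SimpleGraph.Adj.symm, SimpleGraph.Adj.ne])
    have := card_nbrs_toFinset_le (G := G) (l := [a, y, a₁, b, a₂, b₁, w]) (v := w) [a₁] (by
          simp only [List.mem_cons, List.not_mem_nil]
          grind [SimpleGraph.Adj.symm, SimpleGraph.Adj.ne])
    simp only [List.cons_append, List.nil_append, List.map_cons, List.map_nil, List.sum_cons,
      List.sum_nil, List.length_cons, List.length_nil] at *
    omega

/-- There are no vertices of degree two. -/
lemma card_ne_two (h : Irreducible G A X) (hy : y ∈ A) : (nbrs G A y).card ≠ 2 := by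
  intro hd
  obtain ⟨a, b, a₁, a₂, b₁, b₂, hB⟩ := h.exists_bridge hy hd
  have h1 : G.Adj a₁ b₁ ∨ G.Adj a₁ b₂ := by
    by_contra! hc
    exact h.bridge_exists_adj hB (fun h' => h.bridge_not_both hB.swapa h'.1 h'.2) hc.1 hc.2
  have h2 : G.Adj a₂ b₁ ∨ G.Adj a₂ b₂ := by
    by_contra! hc
    exact h.bridge_exists_adj hB.swapa (fun h' => h.bridge_not_both hB h'.1 h'.2) hc.1 hc.2
  have h3 := h.bridge_not_both hB
  have h4 := h.bridge_not_both hB.swapa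
  -- By symmetry each of the four outer vertices has at most one neighbour on the other side, so the
  -- edges between the sides form a perfect matching.
  have h5 : G.Adj a₁ b₁ → ¬ G.Adj a₂ b₁ := fun p q => h.bridge_not_both hB.swap p.symm q.symm
  have h6 : G.Adj a₁ b₂ → ¬ G.Adj a₂ b₂ := fun p q =>
    h.bridge_not_both hB.swap.swapa p.symm q.symm
  rcases h1 with h1 | h1
  · have h2' := h2.resolve_left (h5 h1)
    exact h.bridge_not_matching hB h1 h2' (h3 h1) fun h' => h4 h' h2'
  · have h2' := h2.resolve_right (h6 h1)
    exact h.bridge_not_matching hB.swapb h1 h2' (fun h' => h3 h' h1) (h4 h2')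

end Irreducible

end bridge

/-! ### Cubic graphs via maximum cuts. -/

section cubic

variable {V : Type u} [DecidableEq V] {G : SimpleGraph V} [DecidableRel G.Adj] {A B X : Finset V}

/-- Twice the number of edges inside `B`. -/
def edgeSum (G : SimpleGraph V) [DecidableRel G.Adj] (B : Finset V) : ℕ :=
  ∑ v ∈ B, (nbrs G B v).card

lemma nbrs_erase_self (B : Finset V) (v : V) : nbrs G (B.erase v) v = nbrs G B v :=
  nbrs_erase_of_not_adj G.irrefl

lemma edgeSum_eq {v : V} (hv : v ∈ B) :
    edgeSum G B = edgeSum G (B.erase v) + 2 * (nbrs G B v).card := by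
  have hs : {v} ⊆ B := by simpa using hv
  have h : ∑ u ∈ B.erase v, (nbrs G B u).card =
      (nbrs G B v).card + edgeSum G (B.erase v) := by
    rw [Finset.sum_congr rfl fun u _ => card_nbrs_inter (G := G) hs u, Finset.sum_add_distrib,
      sum_card_nbrs_comm, Finset.sum_singleton, nbrs_erase_self, ← Finset.erase_eq]
    rfl
  rw [edgeSum, ← Finset.add_sum_erase _ _ hv, h]
  ring

/-- A maximum cut of a subcubic graph induces a matching on both sides. -/
lemma exists_cut (hA : ∀ v ∈ A, (nbrs G A v).card ≤ 3) : ∃ B ⊆ A,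
    (∀ v ∈ B, (nbrs G B v).card ≤ 1) ∧ ∀ v ∈ A \ B, (nbrs G (A \ B) v).card ≤ 1 := by
  obtain ⟨B, hB, hmin⟩ := Finset.exists_min_image A.powerset
    (fun B => edgeSum G B + edgeSum G (A \ B)) ⟨∅, by simp⟩
  rw [Finset.mem_powerset] at hB
  -- A vertex with two neighbours on its own side has at most one on the other, so moving it across
  -- would lower the number of uncut edges.
  have key : ∀ B ⊆ A, (∀ B' ⊆ A, edgeSum G B + edgeSum G (A \ B) ≤
      edgeSum G B' + edgeSum G (A \ B')) → ∀ v ∈ B, (nbrs G B v).card ≤ 1 := by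
    intro B hB hmin v hv
    by_contra! hc
    have h1 := hmin (B.erase v) ((Finset.erase_subset _ _).trans hB)
    have h2 := edgeSum_eq (G := G) hv
    have hv' : v ∈ A \ B.erase v := by simp [hB hv]
    have h3 := edgeSum_eq (G := G) hv'
    have e : (A \ B.erase v).erase v = A \ B := by
      ext u; simp only [Finset.mem_erase, Finset.mem_sdiff]
      constructor
      · rintro ⟨h, h', h''⟩; exact ⟨h', fun h3 => h'' ⟨h, h3⟩⟩
      · rintro ⟨h, h'⟩; exact ⟨by rintro rfl; exact h' hv, h, fun h3 => h' h3.2⟩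
    rw [← nbrs_erase_self, e] at h3
    have h4 := card_nbrs_inter (G := G) hB v
    have h5 := hA v (hB hv)
    omega
  refine ⟨B, hB, key B hB fun B' hB' => hmin B' (Finset.mem_powerset.2 hB'),
    key (A \ B) Finset.sdiff_subset fun B' hB' => ?_⟩
  rw [Finset.sdiff_sdiff_eq_self hB, add_comm]
  exact hmin B' (Finset.mem_powerset.2 hB')

/-- Take a maximum independent set as centres. Every other vertex has a centre as its only
neighbour, so the leaves are independent. -/
lemma exists_isStarPair_of_matching (hB : ∀ v ∈ B, (nbrs G B v).card ≤ 1) :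
    ∃ C ⊆ B, IsStarPair G C (B \ C) := by
  obtain ⟨C, hC, hmax⟩ := Finset.exists_max_image
    (B.powerset.filter fun C => ∀ u ∈ C, ∀ v ∈ C, ¬ G.Adj u v) Finset.card ⟨∅, by simp⟩
  rw [Finset.mem_filter, Finset.mem_powerset] at hC
  have huniq : ∀ v ∈ B, ∀ x ∈ B, ∀ y ∈ B, G.Adj v x → G.Adj v y → x = y :=
    fun v hv x hx y hy h h' => Finset.card_le_one.1 (hB v hv) x (mem_nbrs.2 ⟨hx, h⟩) y
      (mem_nbrs.2 ⟨hy, h'⟩)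
  have hnbr : ∀ l ∈ B \ C, ∃ c ∈ C, G.Adj l c := by
    intro l hl
    rw [Finset.mem_sdiff] at hl
    by_contra! hc
    have := hmax (insert l C) (by
      rw [Finset.mem_filter, Finset.mem_powerset]
      refine ⟨Finset.insert_subset hl.1 hC.1, fun u hu v hv h => ?_⟩
      rw [Finset.mem_insert] at hu hv
      rcases hu with rfl | hu <;> rcases hv with rfl | hv
      · exact h.ne rfl
      · exact hc v hv h
      · exact hc u hu h.symm
      · exact hC.2 u hu v hv h)
    rw [Finset.card_insert_of_notMem hl.2] at this
    omega
  refine ⟨C, hC.1, Finset.disjoint_sdiff, hC.2, fun u hu v hv h => ?_, fun l hl c hc c' hc' =>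
    huniq l (Finset.sdiff_subset hl) c (hC.1 hc) c' (hC.1 hc')⟩
  obtain ⟨c, hc, huc⟩ := hnbr u hu
  have := huniq u (Finset.sdiff_subset hu) v (Finset.sdiff_subset hv) c (hC.1 hc) h huc
  subst this
  exact (Finset.mem_sdiff.1 hv).2 hc

lemma hasPacking_of_cubic (hX : ∀ v ∈ A, v ∉ X) (hA : ∀ v ∈ A, (nbrs G A v).card = 3) :
    HasPacking G (1 / 6) A X := by
  obtain ⟨B, hB, h1, h2⟩ := exists_cut fun v hv => (hA v hv).le
  have hsum : ∑ v ∈ A, weight (1 / 6) (v ∈ X) (nbrs G A v).card = (A.card : ℝ) / 2 := by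
    rw [Finset.sum_congr rfl fun v hv => show _ = (1 / 2 : ℝ) by
      rw [weight_unmarked (hX v hv), hA v hv, starBound_sixth_three], Finset.sum_const,
      nsmul_eq_mul]
    ring
  have hcard : (A.card : ℝ) = B.card + (A \ B).card := by
    exact_mod_cast (Finset.card_sdiff_add_card_eq_card hB).symm.trans (add_comm _ _)
  have key : ∀ B ⊆ A, (∀ v ∈ B, (nbrs G B v).card ≤ 1) → (A.card : ℝ) / 2 ≤ B.card →
      HasPacking G (1 / 6) A X := by
    intro B hB h1 hle
    obtain ⟨C, hC, hs⟩ := exists_isStarPair_of_matching h1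
    refine ⟨C, B \ C, hC.trans hB, Finset.sdiff_subset.trans hB, hs, ?_, ?_⟩
    · rw [Finset.disjoint_left]
      exact fun v hv => hX v (hB (Finset.sdiff_subset hv))
    · rw [hsum]
      refine hle.trans (le_of_eq ?_)
      exact_mod_cast (Finset.card_sdiff_add_card_eq_card hC).symm.trans (add_comm _ _)
  rcases le_total (B.card : ℝ) (A \ B).card with h | h
  · exact key (A \ B) Finset.sdiff_subset h2 (by linarith)
  · exact key B hB h1 (by linarith)

end cubic

/-! ### The induction. -/

section main

variable {V : Type u} [DecidableEq V] (G : SimpleGraph V) [DecidableRel G.Adj]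

/-- The lower bound holds inside every vertex set and for every set of marked vertices. -/
theorem hasPacking {ε : ℝ} (h0 : 0 ≤ ε) (h1 : ε ≤ 1 / 6) (A X : Finset V) :
    HasPacking G ε A X := by
  induction A using Finset.strongInduction generalizing ε X with
  | H A ih =>
  by_cases hiso : ∃ v ∈ A, (nbrs G A v).card = 0
  · obtain ⟨v, hv, hd⟩ := hiso
    exact HasPacking.of_isolated h0 h1 hv hd (ih _ (Finset.erase_ssubset hv) h0 h1 X)
  by_cases hleaf : ∃ v ∈ A, v ∉ X ∧ (nbrs G A v).card = 1
  · obtain ⟨v, hv, hvX, hd⟩ := hleaf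
    obtain ⟨z, hz⟩ := Finset.card_eq_one.1 hd
    exact HasPacking.of_leaf h0 hv hvX hz (ih _ (Finset.erase_ssubset hv) h0 h1 _)
  push Not at hiso hleaf
  have d1 : ∀ v ∈ A, 1 ≤ (nbrs G A v).card := fun v hv => Nat.one_le_iff_ne_zero.2 (hiso v hv)
  have d2 : ∀ v ∈ A, v ∉ X → 2 ≤ (nbrs G A v).card := fun v hv hx => by
    have := d1 v hv; have := hleaf v hv hx; omega
  have ih' : ∀ B ⊂ A, HasPacking G (1 / 6) B X := fun B hB =>
    ih B hB (by norm_num) le_rfl X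
  -- Marked weights do not depend on ε, and unmarked degrees are now at least two, so the case 1/6
  -- implies all others.
  suffices h : HasPacking G (1 / 6) A X by
    obtain ⟨C, L, hC, hL, hs, hLX, hsum⟩ := h
    refine ⟨C, L, hC, hL, hs, hLX, le_trans (Finset.sum_le_sum fun v hv => ?_) hsum⟩
    by_cases hx : v ∈ X
    · rw [weight_marked hx, weight_marked hx]
    · rw [weight_unmarked hx, weight_unmarked hx]
      exact starBound_mono h1 (d2 v hv hx)
  by_cases hlarge : ∃ v ∈ A, (v ∈ X ∧ 3 ≤ (nbrs G A v).card) ∨ (v ∉ X ∧ 4 ≤ (nbrs G A v).card)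
  · exact HasPacking.of_large d1 d2 hlarge ih'
  have hA : SmallDegrees G A X := by
    intro v hv
    refine ⟨d1 v hv, fun hx => ?_, fun hx => ⟨d2 v hv hx, ?_⟩⟩
    · by_contra! hc; exact hlarge ⟨v, hv, Or.inl ⟨hx, hc⟩⟩
    · by_contra! hc; exact hlarge ⟨v, hv, Or.inr ⟨hx, hc⟩⟩
  by_cases hm1 : ∃ v ∈ A, v ∈ X ∧ (nbrs G A v).card = 1
  · obtain ⟨v, hv, hvX, hd⟩ := hm1
    exact HasPacking.of_marked_one hA ih' hv hvX hd
  by_cases hm2 : ∃ v ∈ A, v ∈ X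
  · obtain ⟨v, hv, hvX⟩ := hm2
    refine HasPacking.of_marked_two hA (fun w hw hwX => ?_) ih' hv hvX
    have := (hA w hw).2.1 hwX
    have := d1 w hw
    have : (nbrs G A w).card ≠ 1 := fun h => hm1 ⟨w, hw, hwX, h⟩
    omega
  have hX : ∀ v ∈ A, v ∉ X := fun v hv hvX => hm2 ⟨v, hv, hvX⟩
  by_contra hnot
  have hirr : Irreducible G A X := ⟨hA, hX, ih', hnot⟩
  exact hnot (hasPacking_of_cubic hX fun v hv =>
    (hirr.card_eq hv).resolve_left (hirr.card_ne_two hv))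

end main

/-! ### From star pairs to forests of stars, and the lower bound. -/

section graphs

variable {V : Type u} {G : SimpleGraph V}

/-- Forests of stars have no path on four vertices and no triangle. -/
lemma no_walk_of_forestsOfStars (h : forestsOfStars V G) {a b c d : V} (hab : G.Adj a b)
    (hbc : G.Adj b c) (hcd : G.Adj c d) (hac : a ≠ c) (hbd : b ≠ d) : False := by
  have ha : a ∈ G.connectedComponentMk b := SimpleGraph.ConnectedComponent.sound hab.reachable
  have hb : b ∈ G.connectedComponentMk b := rfl
  have hc : c ∈ G.connectedComponentMk b :=
    SimpleGraph.ConnectedComponent.sound hbc.symm.reachable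
  have hd : d ∈ G.connectedComponentMk b :=
    SimpleGraph.ConnectedComponent.sound (hcd.symm.reachable.trans hbc.symm.reachable)
  obtain ⟨r, hr⟩ := h (G.connectedComponentMk b)
  rw [← SimpleGraph.ConnectedComponent.toSimpleGraph_adj _ ha hb, hr,
    SimpleGraph.starGraph_adj] at hab
  rw [← SimpleGraph.ConnectedComponent.toSimpleGraph_adj _ hb hc, hr,
    SimpleGraph.starGraph_adj] at hbc
  rw [← SimpleGraph.ConnectedComponent.toSimpleGraph_adj _ hc hd, hr,
    SimpleGraph.starGraph_adj] at hcd
  obtain ⟨r, hr'⟩ := r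
  simp only [ne_eq, Subtype.mk.injEq] at hab hbc hcd
  grind

/-- No walk leaves the closed neighbourhood of such an `r`, so this neighbourhood is the whole
component. -/
lemma forestsOfStars_of_roots
    (h : ∀ v, ∃ r, (v = r ∨ G.Adj r v) ∧ ∀ x y, G.Adj r x → G.Adj x y → y = r) :
    forestsOfStars V G := by
  intro c
  induction c using SimpleGraph.ConnectedComponent.ind with
  | _ v =>
  obtain ⟨r, hvr, hr⟩ := h v
  have hrv : G.Reachable r v := by
    rcases hvr with rfl | h
    · exact SimpleGraph.Reachable.refl _
    · exact h.reachable
  have hreach : ∀ x, Relation.ReflTransGen G.Adj r x → x = r ∨ G.Adj r x := by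
    intro x hx
    induction hx with
    | refl => exact Or.inl rfl
    | tail _ hbc ih =>
      rcases ih with rfl | hb
      · exact Or.inr hbc
      · exact Or.inl (hr _ _ hb hbc)
  have hmem : ∀ x ∈ G.connectedComponentMk v, x = r ∨ G.Adj r x := fun x hx =>
    hreach x ((SimpleGraph.reachable_iff_reflTransGen _ _).1
      (hrv.trans (SimpleGraph.ConnectedComponent.exact hx).symm))
  refine ⟨⟨r, SimpleGraph.ConnectedComponent.sound hrv⟩, ?_⟩
  ext ⟨x, hx⟩ ⟨y, hy⟩
  rw [SimpleGraph.ConnectedComponent.toSimpleGraph_adj, SimpleGraph.starGraph_adj]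
  constructor
  · intro hxy
    refine ⟨fun h => hxy.ne (congrArg Subtype.val h), ?_⟩
    rcases hmem x hx with h | h
    · exact Or.inl (Subtype.ext h)
    · exact Or.inr (Subtype.ext (hr _ _ h hxy))
  · rintro ⟨hne, h | h⟩
    · obtain rfl : x = r := congrArg Subtype.val h
      exact (hmem y hy).resolve_left fun h => hne (Subtype.ext h.symm)
    · obtain rfl : y = r := congrArg Subtype.val h
      exact ((hmem x hx).resolve_left fun h => hne (Subtype.ext h)).symm

/-- A centre is the root of itself and its leaves; a leaf without a centre is isolated and is its
own root. -/
lemma IsStarPair.forestsOfStars [DecidableEq V] {C L : Finset V} (h : IsStarPair G C L) :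
    forestsOfStars _ (G.induce ((C ∪ L : Finset V) : Set V)) := by
  apply forestsOfStars_of_roots
  have hmem : ∀ x : ((C ∪ L : Finset V) : Set V), x.1 ∈ C ∨ x.1 ∈ L := fun x => by
    simpa using x.2
  have hC : ∀ r : ((C ∪ L : Finset V) : Set V), r.1 ∈ C → ∀ x y,
      (G.induce ((C ∪ L : Finset V) : Set V)).Adj r x →
      (G.induce ((C ∪ L : Finset V) : Set V)).Adj x y → y = r := by
    intro r hr x y hrx hxy
    simp only [SimpleGraph.comap_adj, Function.Embedding.subtype_apply] at hrx hxy
    have hx : x.1 ∈ L := (hmem x).resolve_left fun hx => h.indepC _ hr _ hx hrx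
    have hy : y.1 ∈ C := (hmem y).resolve_right fun hy => h.indepL _ hx _ hy hxy
    exact Subtype.ext (h.uniq _ hx _ hy _ hr hxy hrx.symm)
  intro v
  by_cases hv : ∃ r : ((C ∪ L : Finset V) : Set V), r.1 ∈ C ∧ (v = r ∨ G.Adj r v)
  · obtain ⟨r, hr, hvr⟩ := hv
    exact ⟨r, by simpa using hvr, hC r hr⟩
  · refine ⟨v, Or.inl rfl, fun x y hvx _ => ?_⟩
    simp only [SimpleGraph.comap_adj, Function.Embedding.subtype_apply] at hvx
    have hvL : v.1 ∈ L := (hmem v).resolve_left fun hc => hv ⟨v, hc, Or.inl rfl⟩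
    rcases hmem x with hx | hx
    · exact absurd ⟨x, hx, Or.inr hvx.symm⟩ hv
    · exact absurd hvx (h.indepL _ hvL _ hx)

lemma le_inducedOrder [Fintype V] {C : GraphClass.{u}} {s : Finset V}
    (h : C _ (G.induce (s : Set V))) : s.card ≤ inducedOrder C G := by
  refine le_csSup ⟨Fintype.card V, ?_⟩ ⟨s, h, rfl⟩
  rintro n ⟨t, -, rfl⟩
  exact Finset.card_le_univ t

lemma inducedOrder_le [Fintype V] {C : GraphClass.{u}} {k : ℕ}
    (h : ∀ s : Finset V, C _ (G.induce (s : Set V)) → s.card ≤ k) : inducedOrder C G ≤ k := by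
  unfold inducedOrder
  rcases Set.eq_empty_or_nonempty {n : ℕ | ∃ s : Finset V, C _ (G.induce (s : Set V)) ∧ s.card = n}
    with he | hne
  · rw [he]; simp
  · refine csSup_le hne ?_
    rintro n ⟨s, hs, rfl⟩
    exact h s hs

theorem isLowerBound_starBound {ε : ℝ} (h0 : 0 ≤ ε) (h1 : ε ≤ 1 / 6) :
    IsLowerBound forestsOfStars.{u} (starBound ε) := by
  classical
  refine ⟨starBound_mem_Icc h0 h1, fun V _ G _ => ?_⟩
  obtain ⟨C, L, -, -, hs, -, hsum⟩ := hasPacking G h0 h1 Finset.univ ∅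
  have hle := le_inducedOrder hs.forestsOfStars
  rw [Finset.card_union_of_disjoint hs.disj] at hle
  calc degreeSum (starBound ε) G
      = ∑ v, weight ε (v ∈ (∅ : Finset V)) (nbrs G Finset.univ v).card := by
        refine Finset.sum_congr rfl fun v _ => ?_
        rw [weight_unmarked (by simp), ← SimpleGraph.card_neighborFinset_eq_degree,
          SimpleGraph.neighborFinset_eq_filter]
        rfl
    _ ≤ _ := hsum
    _ ≤ _ := by exact_mod_cast hle

end graphs

/-! ### Test graphs and domination. -/

section upperBounds

variable {φ : ℕ → ℝ}

/-- Testing a lower bound on a graph without large induced forests of stars. -/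
lemma sum_le_of_isLowerBound (hφ : IsLowerBound forestsOfStars.{u} φ) {W : Type} [Fintype W]
    (H : SimpleGraph W) [DecidableRel H.Adj] {k : ℕ} (hk : ∀ s : Finset W,
      (∀ a ∈ s, ∀ b ∈ s, ∀ c ∈ s, ∀ d ∈ s, H.Adj a b → H.Adj b c → H.Adj c d → a ≠ c → b = d) →
      s.card ≤ k) : ∑ w, φ (H.degree w) ≤ k := by
  classical
  let G : SimpleGraph (ULift.{u} W) := H.comap ULift.down
  have hdeg : ∀ v : ULift.{u} W, G.degree v = H.degree v.down := by
    intro v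
    refine Finset.card_bij' (fun x _ => x.down) (fun x _ => ⟨x⟩) ?_ ?_ ?_ ?_ <;> simp [G]
  have h := hφ.2 (ULift.{u} W) G
  have h2 : inducedOrder forestsOfStars G ≤ k := by
    refine inducedOrder_le fun s hs => ?_
    have := hk (s.map ⟨ULift.down, ULift.down_injective⟩) ?_
    · simpa using this
    · intro a ha b hb c hc d hd hab hbc hcd hac
      simp only [Finset.mem_map, Function.Embedding.coeFn_mk] at ha hb hc hd
      obtain ⟨a, ha, rfl⟩ := ha
      obtain ⟨b, hb, rfl⟩ := hb
      obtain ⟨c, hc, rfl⟩ := hc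
      obtain ⟨d, hd, rfl⟩ := hd
      by_contra hbd
      refine no_walk_of_forestsOfStars hs (a := ⟨a, ha⟩) (b := ⟨b, hb⟩) (c := ⟨c, hc⟩)
        (d := ⟨d, hd⟩) hab hbc hcd ?_ ?_
      · rintro h; exact hac (by simpa using congrArg (fun x => x.1.down) h)
      · rintro h; exact hbd (by simpa using congrArg (fun x => x.1.down) h)
  have h3 : degreeSum φ G = ∑ w, φ (H.degree w) := by
    unfold degreeSum
    simp only [hdeg]
    exact Fintype.sum_equiv Equiv.ulift _ _ fun _ => rfl
  rw [← h3]
  exact h.trans (by exact_mod_cast h2)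

lemma le_of_complete (hφ : IsLowerBound forestsOfStars.{u} φ) (d : ℕ) :
    φ d ≤ 2 / ((d : ℝ) + 1) := by
  have h := sum_le_of_isLowerBound hφ (⊤ : SimpleGraph (Fin (d + 1))) (k := 2) ?_
  · simp only [SimpleGraph.complete_graph_degree, Fintype.card_fin, Nat.add_sub_cancel,
      Finset.sum_const, Finset.card_univ, nsmul_eq_mul] at h
    rw [le_div_iff₀ (by positivity)]
    push_cast at h
    linarith
  · intro s hs
    by_contra! hc
    obtain ⟨a, ha, b, hb, c, hc, hab, hac, hbc⟩ := Finset.two_lt_card.1 hc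
    -- A triangle is a forbidden walk whose last vertex equals its first.
    exact hab (hs a ha b hb c hc a ha (by simpa) (by simpa) (by simpa using hac.symm) hac).symm

lemma le_of_cycle (hφ : IsLowerBound forestsOfStars.{u} φ) : φ 2 ≤ 3 / 5 := by
  have h := sum_le_of_isLowerBound hφ (SimpleGraph.cycleGraph 5) (k := 3) ?_
  · simp only [SimpleGraph.cycleGraph_degree_three_le, Finset.sum_const, Finset.card_univ,
      Fintype.card_fin, nsmul_eq_mul] at h
    push_cast at h
    linarith
  · intro s hs
    by_contra! hc
    have : ∀ s : Finset (Fin 5), 3 < s.card → ∃ i, i ∈ s ∧ i + 1 ∈ s ∧ i + 2 ∈ s ∧ i + 3 ∈ s := by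
      decide
    obtain ⟨i, h0, h1, h2, h3⟩ := this s hc
    have hne : ∀ i : Fin 5, i ≠ i + 2 ∧ i + 1 ≠ i + 3 := by decide
    have hadj : ∀ i : Fin 5, (SimpleGraph.cycleGraph 5).Adj i (i + 1) ∧
      (SimpleGraph.cycleGraph 5).Adj (i + 1) (i + 2) ∧
      (SimpleGraph.cycleGraph 5).Adj (i + 2) (i + 3) := by decide
    exact (hne i).2 (hs _ h0 _ h1 _ h2 _ h3 (hadj i).1 (hadj i).2.1 (hadj i).2.2 (hne i).1)

/-- The complete graph with a pendant vertex attached to every vertex. -/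
def corona (d : ℕ) : SimpleGraph (Fin d × Bool) where
  Adj p q := (p.2 = true ∧ q.2 = true ∧ p.1 ≠ q.1) ∨ (p.1 = q.1 ∧ p.2 ≠ q.2)
  symm := ⟨by
    rintro p q (⟨h1, h2, h3⟩ | ⟨h1, h2⟩)
    · exact Or.inl ⟨h2, h1, h3.symm⟩
    · exact Or.inr ⟨h1.symm, h2.symm⟩⟩
  loopless := ⟨by rintro p (⟨-, -, h⟩ | ⟨-, h⟩) <;> exact h rfl⟩

instance (d : ℕ) : DecidableRel (corona d).Adj := fun p q =>
  inferInstanceAs (Decidable ((p.2 = true ∧ q.2 = true ∧ p.1 ≠ q.1) ∨ (p.1 = q.1 ∧ p.2 ≠ q.2)))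

lemma corona_degree_true {d : ℕ} (i : Fin d) : (corona d).degree (i, true) = d := by
  rw [← SimpleGraph.card_neighborFinset_eq_degree]
  refine (Finset.card_bij' (t := (Finset.univ : Finset (Fin d))) (fun p _ => p.1)
    (fun j _ => if j = i then (i, false) else (j, true)) ?_ ?_ ?_ ?_).trans (by simp)
  · simp
  · intro j _
    rw [SimpleGraph.mem_neighborFinset]
    by_cases h : j = i
    · rw [if_pos h]; exact Or.inr ⟨rfl, by simp⟩
    · rw [if_neg h]; exact Or.inl ⟨rfl, rfl, Ne.symm h⟩
  · rintro ⟨j, b⟩ hj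
    rw [SimpleGraph.mem_neighborFinset] at hj
    rcases hj with ⟨-, h, h'⟩ | ⟨h, h'⟩
    · simp_all [Ne.symm h']
    · simp_all
  · intro j _
    by_cases h : j = i <;> simp [h]

lemma corona_degree_false {d : ℕ} (i : Fin d) : (corona d).degree (i, false) = 1 := by
  rw [← SimpleGraph.card_neighborFinset_eq_degree, Finset.card_eq_one]
  refine ⟨(i, true), ?_⟩
  ext ⟨j, b⟩
  rw [SimpleGraph.mem_neighborFinset, Finset.mem_singleton]
  constructor
  · rintro (⟨h, -, -⟩ | ⟨h, h'⟩)
    · exact absurd h (by simp)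
    · exact Prod.ext h.symm (by simpa using h'.symm)
  · intro h
    rw [h]
    exact Or.inr ⟨rfl, by simp⟩

/-- Two clique vertices chosen together with their pendants would form a path on four vertices. So
at most one pair is fully chosen, giving d(φ(d)+φ(1)) ≤ d+1. -/
lemma le_of_corona (hφ : IsLowerBound forestsOfStars.{u} φ) {d : ℕ} (hd : 1 ≤ d) :
    φ d ≤ 1 / (d : ℝ) + (1 - φ 1) := by
  have h := sum_le_of_isLowerBound hφ (corona d) (k := d + 1) ?_
  · rw [Fintype.sum_prod_type] at h
    simp only [Fintype.sum_bool, corona_degree_true, corona_degree_false, Finset.sum_const,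
      Finset.card_univ, Fintype.card_fin, nsmul_eq_mul] at h
    have : (1 : ℝ) ≤ d := by exact_mod_cast hd
    push_cast at h
    have e : (d : ℝ) * (1 / d) = 1 := by field_simp
    by_contra! hc
    nlinarith
  · intro s hs
    have h1 : s.card = ∑ i : Fin d, (s.filter fun p => p.1 = i).card :=
      Finset.card_eq_sum_card_fiberwise fun _ _ => Finset.mem_univ _
    have h2 : ∀ i : Fin d, (s.filter fun p => p.1 = i).card ≤
        1 + if (i, true) ∈ s ∧ (i, false) ∈ s then 1 else 0 := by
      intro i
      split_ifs with h
      · refine (Finset.card_le_card (t := {(i, true), (i, false)}) ?_).trans Finset.card_le_two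
        rintro ⟨j, b⟩ hj
        obtain rfl : j = i := (Finset.mem_filter.1 hj).2
        cases b <;> simp
      · rw [add_zero, Finset.card_le_one]
        rintro ⟨j, b⟩ hj ⟨k, c⟩ hk
        rw [Finset.mem_filter] at hj hk
        obtain rfl : j = i := hj.2
        obtain rfl : k = j := hk.2
        cases b <;> cases c
        · rfl
        · exact absurd ⟨hk.1, hj.1⟩ h
        · exact absurd ⟨hj.1, hk.1⟩ h
        · rfl
    have h3 : (Finset.univ.filter fun i : Fin d => (i, true) ∈ s ∧ (i, false) ∈ s).card ≤ 1 := by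
      rw [Finset.card_le_one]
      intro i hi j hj
      simp only [Finset.mem_filter, Finset.mem_univ, true_and] at hi hj
      by_contra hij
      have := hs _ hi.2 _ hi.1 _ hj.1 _ hj.2 (Or.inr ⟨rfl, by simp⟩)
        (Or.inl ⟨rfl, rfl, hij⟩) (Or.inr ⟨rfl, by simp⟩) (by simp)
      simp at this
    rw [h1]
    refine (Finset.sum_le_sum fun i _ => h2 i).trans ?_
    rw [Finset.sum_add_distrib, ← Finset.card_filter]
    simp only [Finset.sum_const, Finset.card_univ, Fintype.card_fin, smul_eq_mul, mul_one]
    omega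

theorem exists_isDominatedBy (hφ : IsLowerBound forestsOfStars.{u} φ) :
    ∃ ε : ℝ, 0 ≤ ε ∧ ε ≤ 1 / 6 ∧ IsDominatedBy φ (starBound ε) := by
  have h01 := hφ.1 1
  have hmin : ∀ d : ℕ, 1 ≤ d → φ d ≤ 1 / (d : ℝ) + 1 / 6 →
      φ d ≤ 1 / (d : ℝ) + min (1 / 6) (1 - φ 1) := fun d hd h => by
    rw [← min_add_add_left]
    exact le_min h (le_of_corona hφ hd)
  -- Truncating at 1/6 costs nothing, since 3/5 ≤ 1/2+1/6 and 2/(d+1) ≤ 1/d+1/6 for d ≥ 3.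
  refine ⟨min (1 / 6) (1 - φ 1), le_min (by norm_num) (by linarith [h01.2]), min_le_left _ _,
    fun d => ?_⟩
  rcases (by omega : d = 0 ∨ d = 1 ∨ d = 2 ∨ 3 ≤ d) with rfl | rfl | rfl | h
  · exact (hφ.1 0).2
  · rw [starBound_one]
    linarith [min_le_right (1 / 6 : ℝ) (1 - φ 1)]
  · rw [starBound_two]
    have h2 := le_of_cycle hφ
    exact le_min h2 (by simpa using hmin 2 (by norm_num) (h2.trans (by norm_num)))
  · rw [starBound_of_three_le _ h]
    have h2 := le_of_complete hφ d
    refine le_min h2 (hmin d (by omega) ?_)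
    rw [← starBound_sixth h] at h2
    exact h2.trans (starBound_le_add (by norm_num) (by omega))

end upperBounds

end StarForest

/-! ### Extremality and conclusion. -/

open StarForest in
theorem mainTheorem6 :
    (∀ ε : ℝ, 0 ≤ ε → ε ≤ 1 / 6 →
      IsExtremalLowerBound forestsOfStars.{u} (starBound ε)) ∧
    (∀ φ : ℕ → ℝ, IsLowerBound forestsOfStars.{u} φ →
      ∃ ε : ℝ, 0 ≤ ε ∧ ε ≤ 1 / 6 ∧ IsDominatedBy φ (starBound ε)) := by
  refine ⟨fun ε h0 h1 => ⟨isLowerBound_starBound h0 h1, ?_⟩, fun φ hφ => exists_isDominatedBy hφ⟩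
  rintro ⟨g, hg, hg0, hlb⟩
  obtain ⟨δ, -, hδ, hdom⟩ := exists_isDominatedBy hlb
  have hle : ∀ d, starBound ε d + g d ≤ starBound δ d := hdom
  have e1 : starBound ε 1 ≤ starBound δ 1 := by linarith [hle 1, (hg 1).1]
  have e3 : starBound ε 3 ≤ starBound δ 3 := by linarith [hle 3, (hg 3).1]
  -- Degree one gives δ ≤ ε. At degree three the minimum for ε is 1/3+ε, because ε ≤ 1/6, and this
  -- gives ε ≤ δ.
  have heq : δ = ε := by
    rw [starBound_one, starBound_one] at e1
    rw [starBound_of_three_le _ le_rfl, starBound_of_three_le _ le_rfl] at e3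
    have e4 := e3.trans (min_le_right _ _)
    push_cast at e4
    rw [min_eq_right (by linarith)] at e4
    linarith
  subst heq
  refine hg0 (funext fun d => le_antisymm ?_ (hg d).1)
  have := hle d
  simp only [Pi.zero_apply]
  linarith
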